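/- Conventions. Alphabets are finite; $\lambda$ is the empty word. A (multi-valued partial) function is a map $f:\Sigma^*\to\mathcal P(\Gamma^*)$ for alphabets $\Sigma,\Gamma$; its domain is $\mathrm{dom}(f)=\{x : f(x)\neq\emptyset\}$, and it is single-valued if $|f(x)|\le 1$ for all $x$. A function $f$ is a refinement of $g$ if $\mathrm{dom}(f)=\mathrm{dom}(g)$ and $f(x)\subseteq g(x)$ for all $x$. An npda is a one-way one-head nondeterministic pushdown automaton that reads its input between two endmarkers, may make $\lambda$-moves, and has accepting and rejecting halting states. An npda with output has in addition a write-only output tape, on which each move writes at most one symbol; all its computation paths are required to reach a halting state within $O(n)$ steps on inputs of length $n$. Its valid outputs on $x$ are the words on the output tape at the end of the accepting computation paths on $x$. An oracle npda has in addition a write-only query tape, on which each move writes at most one symbol, and three special states $q_{query},q_{yes},q_{no}$: when it is in state $q_{query}$, the word $s$ on the query tape is sent to the oracle $A$, the query tape is erased, and the next state is $q_{yes}$ if $s\in A$ and $q_{no}$ if $s\notin A$. All computation paths are required to reach a halting state within $O(n)$ steps on inputs of length $n$, no matter what oracle is used. For a language $A$, let $\mathrm{CFL}_T^{A}$ be the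 family of languages recognized by oracle npda's (without output tape) with oracle $A$, let $\mathrm{CFLMV}_T^{A}$ be the class of functions $f$ for which some oracle npda with an output tape has, with oracle $A$, exactly $f(x)$ as its set of valid outputs on every input $x$, and let $\mathrm{CFLSV}_T^{A}$ be the class of single-valued functions in $\mathrm{CFLMV}_T^{A}$. For a language family $\mathcal C$, let $\mathrm{CFL}_T(\mathcal C)$, $\mathrm{CFLMV}_T(\mathcal C)$ and $\mathrm{CFLSV}_T(\mathcal C)$ be the unions of these classes over all $A\in\mathcal C$. Let $\Sigma_1^{\mathrm{CFL}}$ be the family of context-free languages and, for $k\ge1$, let $\Pi_k^{\mathrm{CFL}}$ be the family of complements of the languages in $\Sigma_k^{\mathrm{CFL}}$ and $$\Sigma_{k+1}^{\mathrm{CFL}}=\mathrm{CFL}_T(\Pi_k^{\mathrm{CFL}}),\qquad \Sigma_{k+1}^{\mathrm{CFL}}\mathrm{MV}=\mathrm{CFLMV}_T(\Pi_k^{\mathrm{CFL}}),\qquad \Sigma_{k+1}^{\mathrm{CFL}}\mathrm{SV}=\mathrm{CFLSV}_T(\Pi_k^{\mathrm{CFL}}),$$ where $\Sigma_1^{\mathrm{CFL}}\mathrm{MV}$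 is the class of functions computed by npda's with output, and $\Sigma_1^{\mathrm{CFL}}\mathrm{SV}$ is the class of its single-valued members. Proposition. Let $k\ge 2$. If $\Sigma_k^{\mathrm{CFL}}=\Sigma_{k+1}^{\mathrm{CFL}}$, then $\Sigma_{k+1}^{\mathrm{CFL}}\mathrm{MV}\sqsubseteq_{ref}\Sigma_{k+1}^{\mathrm{CFL}}\mathrm{SV}$, that is, every function in $\Sigma_{k+1}^{\mathrm{CFL}}\mathrm{MV}$ has a (single-valued) refinement in $\Sigma_{k+1}^{\mathrm{CFL}}\mathrm{SV}$. -/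

import Mathlib

namespace CFLHierarchy

/-! ### Machines -/

/-- Cells of the input tape: input symbols together with the two endmarkers. -/
inductive TapeSymbol (σ : Type) : Type
  | leftEnd : TapeSymbol σ
  | rightEnd : TapeSymbol σ
  | letter : σ → TapeSymbol σ

/-- The input tape that carries the word `x` between the endmarkers. -/
def inputTape {σ : Type} (x : List σ) : List (TapeSymbol σ) :=
  TapeSymbol.leftEnd :: (x.map TapeSymbol.letter ++ [TapeSymbol.rightEnd])

/-- A one-way one-head nondeterministic pushdown automaton over the input alphabet `σ`. Each
transition also carries an element of `W` that says what is written on the write-only tapes.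
The first argument of type `Option` of `δ` is the scanned symbol, or `none` for a `λ`-move.
The values of `δ` at halting states are never used. -/
structure PDA (σ W : Type) : Type 1 where
  /-- inner states -/
  Q : Type
  /-- stack alphabet -/
  Θ : Type
  finite_Q : Finite Q
  finite_Θ : Finite Θ
  /-- transition function -/
  δ : Q → Option (TapeSymbol σ) → Θ → Set (Q × List Θ × W)
  finite_δ : ∀ q a Z, (δ q a Z).Finite
  /-- initial state -/
  q₀ : Q
  /-- bottom marker of the stack -/
  Z₀ : Θ
  /-- accepting states -/
  acc : Set Q
  /-- rejecting states -/
  rej : Set Q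
  disjoint_acc_rej : Disjoint acc rej

namespace PDA

variable {σ W : Type}

/-- The halting states. -/
def halt (M : PDA σ W) : Set M.Q := M.acc ∪ M.rej

/-- State, part of the input tape that has not been read yet, and stack (top first). -/
structure Cfg (M : PDA σ W) : Type where
  state : M.Q
  input : List (TapeSymbol σ)
  stack : List M.Θ

/-- The initial configuration on input `x`. -/
def start (M : PDA σ W) (x : List σ) : M.Cfg := ⟨M.q₀, inputTape x, [M.Z₀]⟩

/-- `M.Move c w c'`: a transition out of a non-halting state leads from `c` to `c'` and
writes `w`. It reads one tape symbol or none (`λ`-move), and it replaces the topmost stack symbol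
by a word. -/
def Move (M : PDA σ W) (c : M.Cfg) (w : W) (c' : M.Cfg) : Prop :=
  c.state ∉ M.halt ∧
    ∃ (a : Option (TapeSymbol σ)) (Z : M.Θ) (u s : List M.Θ),
      c.input = a.toList ++ c'.input ∧
      c.stack = Z :: s ∧ c'.stack = u ++ s ∧
      (c'.state, u, w) ∈ M.δ c.state a Z

end PDA

/-- All computation paths from `c` reach a halted configuration within `t` steps; in particular
no path gets stuck in a configuration that is not halted. -/
def HaltsWithin {C : Type} (step : C → C → Prop) (halted : C → Prop) : ℕ → C → Prop
  | 0, c => halted c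
  | t + 1, c =>
      halted c ∨ ((∃ d, step c d) ∧ ∀ d, step c d → HaltsWithin step halted t d)

/-! ### Machines with an output tape -/

/-- An npda with a write-only output tape over `γ`; each move writes one symbol or none. -/
abbrev Transducer (σ γ : Type) : Type 1 := PDA σ (Option γ)

namespace Transducer

variable {σ γ : Type}

/-- One step; configurations are paired with the content of the output tape. -/
def Step (M : Transducer σ γ) (c d : PDA.Cfg M × List γ) : Prop :=
  ∃ w : Option γ, PDA.Move M c.1 w d.1 ∧ d.2 = c.2 ++ w.toList

/-- All computation paths on inputs of length `n` halt in `O(n)` steps. -/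
def LinearTime (M : Transducer σ γ) : Prop :=
  ∃ a b : ℕ, ∀ x : List σ,
    HaltsWithin (Step M) (fun c => c.1.state ∈ PDA.halt M) (a * x.length + b)
      (PDA.start M x, [])

/-- The set of valid outputs on input `x`: those produced along accepting computation paths. -/
def outputs (M : Transducer σ γ) (x : List σ) : Set (List γ) :=
  {z | ∃ c : PDA.Cfg M, c.state ∈ M.acc ∧
    Relation.ReflTransGen (Step M) (PDA.start M x, []) (c, z)}

end Transducer

/-! ### Oracle machines -/

/-- An npda with a write-only output tape over `γ` and a write-only query tape over `β`; each move
writes at most one symbol on each of them. It has three special states for its queries. The values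
of `δ` at the query state are never used. -/
structure OracleNPDA (σ γ β : Type) : Type 1 extends PDA σ (Option γ × Option β) where
  qQuery : Q
  qYes : Q
  qNo : Q
  query_ne_yes : qQuery ≠ qYes
  query_ne_no : qQuery ≠ qNo
  yes_ne_no : qYes ≠ qNo
  query_not_halt : qQuery ∉ acc ∪ rej
  yes_not_halt : qYes ∉ acc ∪ rej
  no_not_halt : qNo ∉ acc ∪ rej

namespace OracleNPDA

variable {σ γ β : Type}

/-- A configuration of the automaton with the contents of the query tape and the output tape. -/
structure OCfg (M : OracleNPDA σ γ β) : Type where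
  cfg : M.toPDA.Cfg
  query : List β
  output : List γ

/-- The initial configuration on input `x`. -/
def start (M : OracleNPDA σ γ β) (x : List σ) : M.OCfg := ⟨M.toPDA.start x, [], []⟩

/-- One step relative to the oracle `A`. In the query state the word on the query tape is sent to
the oracle, the query tape is erased, and the answer determines the next state. -/
inductive Step (M : OracleNPDA σ γ β) (A : Language β) : M.OCfg → M.OCfg → Prop
  | move (c d : M.toPDA.Cfg) (y : List β) (z : List γ) (w : Option γ × Option β)
      (hq : c.state ≠ M.qQuery) (hm : M.toPDA.Move c w d) :
      Step M A ⟨c, y, z⟩ ⟨d, y ++ w.2.toList, z ++ w.1.toList⟩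
  | yes (c : M.toPDA.Cfg) (y : List β) (z : List γ)
      (hq : c.state = M.qQuery) (hy : y ∈ A) :
      Step M A ⟨c, y, z⟩ ⟨⟨M.qYes, c.input, c.stack⟩, [], z⟩
  | no (c : M.toPDA.Cfg) (y : List β) (z : List γ)
      (hq : c.state = M.qQuery) (hy : y ∉ A) :
      Step M A ⟨c, y, z⟩ ⟨⟨M.qNo, c.input, c.stack⟩, [], z⟩

/-- All computation paths on inputs of length `n` halt in `O(n)` steps, no matter what oracle is
used. -/
def LinearTime (M : OracleNPDA σ γ β) : Prop :=
  ∃ a b : ℕ, ∀ (A : Language β) (x : List σ),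
    HaltsWithin (M.Step A) (fun c => c.cfg.state ∈ M.toPDA.halt) (a * x.length + b) (M.start x)

/-- The set of valid outputs on input `x` relative to the oracle `A`. -/
def outputs (M : OracleNPDA σ γ β) (A : Language β) (x : List σ) : Set (List γ) :=
  {z | ∃ c : M.OCfg, c.cfg.state ∈ M.acc ∧ c.output = z ∧
    Relation.ReflTransGen (M.Step A) (M.start x) c}

/-- The machine accepts the input `x` relative to the oracle `A`. -/
def Accepts (M : OracleNPDA σ γ β) (A : Language β) (x : List σ) : Prop :=
  ∃ c : M.OCfg, c.cfg.state ∈ M.acc ∧ Relation.ReflTransGen (M.Step A) (M.start x) c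

end OracleNPDA

/-! ### Language families and the CFL hierarchy -/

/-- A family of languages over finite alphabets. -/
abbrev LanguageFamily : Type 1 := (σ : Type) → [Finite σ] → Set (Language σ)

/-- The family of context-free languages. -/
def CFL : LanguageFamily := fun _ _ => {L | L.IsContextFree}

/-- The family of complements of the languages in `𝒞`. -/
def coFamily (𝒞 : LanguageFamily) : LanguageFamily := fun σ _ => {L | Lᶜ ∈ 𝒞 σ}

/-- Languages recognized relative to `A` by linear-time oracle npda's. These machines have no
output tape: the output alphabet is empty. -/
def CFLT {β : Type} (A : Language β) : LanguageFamily := fun σ _ =>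
  {L | ∃ M : OracleNPDA σ Empty β, M.LinearTime ∧ ∀ x, x ∈ L ↔ M.Accepts A x}

/-- The union of `CFLT A` over all `A` in `𝒞`. -/
def CFLTFamily (𝒞 : LanguageFamily) : LanguageFamily := fun σ _ =>
  {L | ∃ (β : Type) (_ : Finite β) (A : Language β), A ∈ 𝒞 β ∧ L ∈ CFLT A σ}

/-- The levels `Σ_k` of the CFL hierarchy for `k ≥ 1`; index `0` is not used. -/
def SigmaCFL : ℕ → LanguageFamily
  | 0 => fun _ _ => ∅
  | 1 => CFL
  | k + 2 => CFLTFamily (coFamily (SigmaCFL (k + 1)))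

/-- The levels `Π_k` of the CFL hierarchy for `k ≥ 1`. -/
def PiCFL (k : ℕ) : LanguageFamily := coFamily (SigmaCFL k)

/-! ### Multi-valued partial functions -/

/-- Multi-valued partial functions from words over `σ` to words over `γ`. -/
abbrev MVFun (σ γ : Type) : Type := List σ → Set (List γ)

namespace MVFun

variable {σ γ : Type}

/-- The domain of definition. -/
def dom (f : MVFun σ γ) : Set (List σ) := {x | (f x).Nonempty}

/-- At most one value at every word. -/
def SingleValued (f : MVFun σ γ) : Prop := ∀ x, (f x).Subsingleton

/-- `f` is a refinement of `g`. -/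
def IsRefinementOf (f g : MVFun σ γ) : Prop := dom f = dom g ∧ ∀ x, f x ⊆ g x

end MVFun

/-- A class of multi-valued partial functions between words over finite alphabets. -/
abbrev FunctionClass : Type 1 :=
  (σ γ : Type) → [Finite σ] → [Finite γ] → Set (MVFun σ γ)

/-- The single-valued functions of a class. -/
def FunctionClass.singleValued (𝓕 : FunctionClass) : FunctionClass := fun σ γ _ _ =>
  {f | f ∈ 𝓕 σ γ ∧ MVFun.SingleValued f}

/-- Every function in `𝓖` is refined by some function in `𝓕`. -/
def FunctionClass.RefinedBy (𝓖 𝓕 : FunctionClass) : Prop :=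
  ∀ (σ γ : Type) [Finite σ] [Finite γ] (g : MVFun σ γ), g ∈ 𝓖 σ γ →
    ∃ f : MVFun σ γ, f ∈ 𝓕 σ γ ∧ MVFun.IsRefinementOf f g

/-- Functions computed by linear-time npda's with an output tape. -/
def CFLMV : FunctionClass := fun σ γ _ _ =>
  {f | ∃ M : Transducer σ γ, Transducer.LinearTime M ∧ ∀ x, f x = Transducer.outputs M x}

/-- Functions computed relative to `A` by linear-time oracle npda's with an output tape. -/
def CFLMVT {β : Type} (A : Language β) : FunctionClass := fun σ γ _ _ =>
  {f | ∃ M : OracleNPDA σ γ β, M.LinearTime ∧ ∀ x, f x = M.outputs A x}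

/-- The single-valued functions in `CFLMV`. -/
def CFLSV : FunctionClass := FunctionClass.singleValued CFLMV

/-- The single-valued functions in `CFLMVT A`. -/
def CFLSVT {β : Type} (A : Language β) : FunctionClass := FunctionClass.singleValued (CFLMVT A)

/-- The union of `CFLMVT A` over all `A` in `𝒞`. -/
def CFLMVTFamily (𝒞 : LanguageFamily) : FunctionClass := fun σ γ _ _ =>
  {f | ∃ (β : Type) (_ : Finite β) (A : Language β), A ∈ 𝒞 β ∧ f ∈ CFLMVT A σ γ}

/-- The union of `CFLSVT A` over all `A` in `𝒞`. -/
def CFLSVTFamily (𝒞 : LanguageFamily) : FunctionClass := fun σ γ _ _ =>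
  {f | ∃ (β : Type) (_ : Finite β) (A : Language β), A ∈ 𝒞 β ∧ f ∈ CFLSVT A σ γ}

/-- The classes `Σ_k MV` for `k ≥ 1`; index `0` is not used. -/
def SigmaCFLMV : ℕ → FunctionClass
  | 0 => fun _ _ _ _ => ∅
  | 1 => CFLMV
  | k + 2 => CFLMVTFamily (PiCFL (k + 1))

/-- The classes `Σ_k SV` for `k ≥ 1`; index `0` is not used. -/
def SigmaCFLSV : ℕ → FunctionClass
  | 0 => fun _ _ _ _ => ∅
  | 1 => CFLSV
  | k + 2 => CFLSVTFamily (PiCFL (k + 1))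

end CFLHierarchy

/-! Let `M` compute the given function with an oracle `A` in Π_k. An accepting path of `M` can be
written as a word: its transitions and oracle answers, followed by the tape symbols left unread. The
tape symbols occurring in such a word spell out the input tape, so the word determines input and
output. A numbering of the labels orders paths lexicographically. On a fixed input no accepting path
is a proper prefix of another, because accepting states halt; hence exactly one accepting path is
least whenever there is one, and its output defines a single-valued refinement.

The crux is that the words `z` that do not encode a least accepting path are recognized by a
pushdown automaton with the same oracle `A`. It follows `z` and accepts as soon as a label is wrong
or the path turns out not to be accepting. Alternatively it leaves `z` at some transition for one
with a smaller number and simulates `M` freely from there, taking tape symbols from the rest of `z`;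
it accepts if that simulation does. Up to the divergence both paths have the same stack and query
tape, so one copy of each suffices. Oracle answers are forced, so the first difference between two
paths is at a transition. The rejected words thus form a language in Σ_{k+1} = Σ_k, and its
complement is an admissible oracle in Π_k for a second machine, which guesses `z` along its input,
writes the output of `z`, and submits `z` as its only query.

Both machines must run in linear time on all inputs and for all oracles, in particular on words that
encode nothing. The checker therefore tracks whether the tape symbols seen form a prefix of some
input tape, which makes the time bound of `M` applicable to the simulated path; the guesser uses its
stack as a clock. Both are written as a `Prog` and translated by `Prog.toOracleNPDA`. The main steps
are `checker_outputs_nonempty_iff`, `checker_bounded`, `mem_guesser_outputs_iff`,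
`exists_encodesLeast` and `EncodesLeast.unique`, assembled in `exists_refinement`. -/

namespace CFLHierarchy

/-! ### Counting steps -/

/-- `Steps R n c d`: there is a path of `n` steps of `R` from `c` to `d`. -/
inductive Steps {C : Type} (R : C → C → Prop) : ℕ → C → C → Prop
  | refl (c : C) : Steps R 0 c c
  | tail {n : ℕ} {c d e : C} : Steps R n c d → R d e → Steps R (n + 1) c e

namespace Steps

variable {C : Type} {R : C → C → Prop}

theorem head {n : ℕ} {c d e : C} (h : R c d) (hs : Steps R n d e) : Steps R (n + 1) c e := by
  induction hs with
  | refl => exact .tail (.refl _) h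
  | tail _ h' ih => exact .tail (ih h) h'

theorem reflTransGen {n : ℕ} {c d : C} (h : Steps R n c d) : Relation.ReflTransGen R c d := by
  induction h with
  | refl => exact .refl
  | tail _ h' ih => exact ih.tail h'

theorem exists_of_reflTransGen {c d : C} (h : Relation.ReflTransGen R c d) :
    ∃ n, Steps R n c d := by
  induction h with
  | refl => exact ⟨0, .refl _⟩
  | tail _ h' ih => exact ih.imp' (· + 1) fun _ h => h.tail h'

theorem cases_head {n : ℕ} {c e : C} (h : Steps R n c e) :
    (n = 0 ∧ c = e) ∨ ∃ m d, n = m + 1 ∧ R c d ∧ Steps R m d e := by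
  induction h with
  | refl => exact .inl ⟨rfl, rfl⟩
  | @tail n c d e hs h' ih =>
    right
    rcases ih with ⟨rfl, rfl⟩ | ⟨m, d', rfl, h1, h2⟩
    · exact ⟨0, e, rfl, h', .refl _⟩
    · exact ⟨m + 1, d', rfl, h1, h2.tail h'⟩

end Steps

/-- Splits linear time into two facts that an invariant of the reachable configurations can supply:
a bound on path lengths, and the absence of stuck configurations. -/
theorem HaltsWithin.of_bounded {C : Type} {R : C → C → Prop} {halted : C → Prop} :
    ∀ (t : ℕ) (c : C), (∀ n d, Steps R n c d → n ≤ t) →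
      (∀ n d, Steps R n c d → halted d ∨ ∃ e, R d e) → HaltsWithin R halted t c
  | 0, c, hb, hp => by
    rcases hp 0 c (.refl _) with h | ⟨e, he⟩
    · exact h
    · exact absurd (hb 1 e (.tail (.refl _) he)) (by omega)
  | t + 1, c, hb, hp => by
    rcases hp 0 c (.refl _) with h | he
    · exact .inl h
    · refine .inr ⟨he, fun d hd => of_bounded t d (fun n e hs => ?_) fun n e hs => ?_⟩
      · have := hb _ _ (hs.head hd)
        omega
      · exact hp _ _ (hs.head hd)

theorem HaltsWithin.steps_le {C : Type} {R : C → C → Prop} {halted : C → Prop}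
    (hh : ∀ c d, halted c → ¬ R c d) :
    ∀ {t : ℕ} {c : C}, HaltsWithin R halted t c → ∀ {n : ℕ} {d : C}, Steps R n c d → n ≤ t
  | 0, c, h, n, d, hs => by
    rcases hs.cases_head with ⟨rfl, _⟩ | ⟨m, e, _, he, _⟩
    · rfl
    · exact absurd he (hh _ _ h)
  | t + 1, c, h, n, d, hs => by
    rcases hs.cases_head with ⟨rfl, _⟩ | ⟨m, e, rfl, he, hs'⟩
    · omega
    · rcases h with h | ⟨_, h⟩
      · exact absurd he (hh _ _ h)
      · have := steps_le hh (h e he) hs'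
        omega

instance {σ : Type} [Finite σ] : Finite (TapeSymbol σ) :=
  Finite.of_surjective
    (fun o : Option (Option σ) => match o with
      | none => TapeSymbol.leftEnd
      | some none => TapeSymbol.rightEnd
      | some (some a) => TapeSymbol.letter a)
    (by rintro (_ | _ | a)
        exacts [⟨none, rfl⟩, ⟨some none, rfl⟩, ⟨some (some a), rfl⟩])

/-! ### Pushdown programs -/

/-- A more convenient form of oracle pushdown automata: a move may test whether the stack is
empty, a query does not destroy the inner state, and computations may get stuck. -/
structure Prog (σ γ β : Type) : Type 1 where
  /-- inner states -/
  Q : Type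
  /-- stack alphabet -/
  Θ : Type
  finite_Q : Finite Q
  finite_Θ : Finite Θ
  /-- transition function; its third argument is `none` when the stack is empty -/
  δ : Q → Option (TapeSymbol σ) → Option Θ → Set (Q × List Θ × (Option γ × Option β))
  finite_δ : ∀ q a Z, (δ q a Z).Finite
  /-- initial state -/
  q₀ : Q
  /-- accepting states -/
  acc : Set Q
  /-- for query states, the next state as a function of the oracle answer -/
  ask : Q → Option (Bool → Q)

namespace Prog

variable {σ γ β : Type}

/-- A configuration with the contents of all tapes. -/
structure Cfg (P : Prog σ γ β) : Type where
  state : P.Q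
  input : List (TapeSymbol σ)
  stack : List P.Θ
  query : List β
  output : List γ

/-- The initial configuration on input `x`. -/
def start (P : Prog σ γ β) (x : List σ) : P.Cfg := ⟨P.q₀, inputTape x, [], [], []⟩

/-- One step relative to the oracle `A`. -/
inductive Step (P : Prog σ γ β) (A : Language β) : P.Cfg → P.Cfg → Prop
  | move {q : P.Q} {i i' : List (TapeSymbol σ)} {s : List P.Θ} {y : List β} {z : List γ}
      {a : Option (TapeSymbol σ)} {q' : P.Q} {u : List P.Θ} {w : Option γ × Option β}
      (hacc : q ∉ P.acc) (hask : P.ask q = none) (hi : i = a.toList ++ i')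
      (hδ : (q', u, w) ∈ P.δ q a s.head?) :
      Step P A ⟨q, i, s, y, z⟩ ⟨q', i', u ++ s.tail, y ++ w.2.toList, z ++ w.1.toList⟩
  | ask {q : P.Q} {i : List (TapeSymbol σ)} {s : List P.Θ} {y : List β} {z : List γ}
      {r : Bool → P.Q} (b : Bool) (hacc : q ∉ P.acc) (hask : P.ask q = some r)
      (hb : b = true ↔ y ∈ A) :
      Step P A ⟨q, i, s, y, z⟩ ⟨r b, i, s, [], z⟩

/-- All computation paths have length linear in the length of the input. -/
def Bounded (P : Prog σ γ β) : Prop :=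
  ∃ a b : ℕ, ∀ (A : Language β) (x : List σ) (n : ℕ) (c : P.Cfg),
    Steps (P.Step A) n (P.start x) c → n ≤ a * x.length + b

/-- The set of valid outputs on input `x` relative to the oracle `A`. -/
def outputs (P : Prog σ γ β) (A : Language β) (x : List σ) : Set (List γ) :=
  {z | ∃ c : P.Cfg, c.state ∈ P.acc ∧ c.output = z ∧
    Relation.ReflTransGen (P.Step A) (P.start x) c}

/-! #### Translation into oracle pushdown automata -/

/-- States of the automaton that simulates a program. -/
inductive SimState (Q : Type) : Type
  | run : Q → SimState Q
  | query : SimState Q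
  | yes : SimState Q
  | no : SimState Q
  | rej : SimState Q

/-- Stack symbols of the automaton that simulates a program: a bottom marker, the stack symbols
of the program, and the states to which a query returns. -/
inductive SimSymbol (Q Θ : Type) : Type
  | bot : SimSymbol Q Θ
  | sym : Θ → SimSymbol Q Θ
  | ret : Q → SimSymbol Q Θ

instance {Q : Type} [Finite Q] : Finite (SimState Q) :=
  Finite.of_surjective
    (fun o : Q ⊕ Fin 4 => match o with
      | .inl q => SimState.run q
      | .inr 0 => .query
      | .inr 1 => .yes
      | .inr 2 => .no
      | .inr 3 => .rej)
    (by rintro (q | _ | _ | _ | _)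
        exacts [⟨.inl q, rfl⟩, ⟨.inr 0, rfl⟩, ⟨.inr 1, rfl⟩, ⟨.inr 2, rfl⟩, ⟨.inr 3, rfl⟩])

instance {Q Θ : Type} [Finite Q] [Finite Θ] : Finite (SimSymbol Q Θ) :=
  Finite.of_surjective
    (fun o : Option (Θ ⊕ Q) => match o with
      | none => SimSymbol.bot
      | some (.inl Z) => .sym Z
      | some (.inr q) => .ret q)
    (by rintro (_ | Z | q)
        exacts [⟨none, rfl⟩, ⟨some (.inl Z), rfl⟩, ⟨some (.inr q), rfl⟩])

/-- The transitions of the automaton that simulates `P`. A simulation may be given up at any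
time. -/
inductive SimMove (P : Prog σ γ β) : SimState P.Q → Option (TapeSymbol σ) → SimSymbol P.Q P.Θ →
    SimState P.Q × List (SimSymbol P.Q P.Θ) × (Option γ × Option β) → Prop
  -- Programs may get stuck, oracle automata may not. This move supplies a successor wherever the
  -- program has none, and adds no accepting path.
  | giveUp (s : SimState P.Q) (Z : SimSymbol P.Q P.Θ) :
      SimMove P s none Z (.rej, [Z], (none, none))
  | sym {q : P.Q} {a : Option (TapeSymbol σ)} {Z : P.Θ} {q' : P.Q} {u : List P.Θ}
      {w : Option γ × Option β} (hask : P.ask q = none) (hδ : (q', u, w) ∈ P.δ q a (some Z)) :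
      SimMove P (.run q) a (.sym Z) (.run q', u.map .sym, w)
  | bot {q : P.Q} {a : Option (TapeSymbol σ)} {q' : P.Q} {u : List P.Θ}
      {w : Option γ × Option β} (hask : P.ask q = none) (hδ : (q', u, w) ∈ P.δ q a none) :
      SimMove P (.run q) a .bot (.run q', u.map .sym ++ [.bot], w)
  -- The query state erases the inner state. The asking state is saved on the stack, since the next
  -- state depends on an answer not yet known.
  | ask {q : P.Q} {r : Bool → P.Q} (Z : SimSymbol P.Q P.Θ) (hask : P.ask q = some r) :
      SimMove P (.run q) none Z (.query, [.ret q, Z], (none, none))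
  | yes {q : P.Q} {r : Bool → P.Q} (hask : P.ask q = some r) :
      SimMove P .yes none (.ret q) (.run (r true), [], (none, none))
  | no {q : P.Q} {r : Bool → P.Q} (hask : P.ask q = some r) :
      SimMove P .no none (.ret q) (.run (r false), [], (none, none))

theorem finite_simMove (P : Prog σ γ β) (s : SimState P.Q) (a : Option (TapeSymbol σ))
    (Z : SimSymbol P.Q P.Θ) : {v | SimMove P s a Z v}.Finite := by
  have := P.finite_Q
  have := P.finite_Θ
  have h1 : (⋃ (q : P.Q) (Z : P.Θ),
      (fun v : P.Q × List P.Θ × (Option γ × Option β) =>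
        (SimState.run v.1, v.2.1.map (SimSymbol.sym (Q := P.Q)), v.2.2)) ''
          P.δ q a (some Z)).Finite :=
    Set.finite_iUnion fun q => Set.finite_iUnion fun Z => (P.finite_δ q a (some Z)).image _
  have h2 : (⋃ q : P.Q,
      (fun v : P.Q × List P.Θ × (Option γ × Option β) =>
        (SimState.run v.1, v.2.1.map (SimSymbol.sym (Q := P.Q)) ++ [.bot], v.2.2)) ''
          P.δ q a none).Finite :=
    Set.finite_iUnion fun q => (P.finite_δ q a none).image _
  have h3 : (Set.range fun v : SimState P.Q × P.Q =>
      ((v.1, [.ret v.2, Z], (none, none)) :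
        SimState P.Q × List (SimSymbol P.Q P.Θ) × (Option γ × Option β))).Finite :=
    Set.finite_range _
  have h4 : (Set.range fun v : SimState P.Q =>
      ((v, [], (none, none)) :
        SimState P.Q × List (SimSymbol P.Q P.Θ) × (Option γ × Option β))).Finite :=
    Set.finite_range _
  have h5 : (Set.range fun v : SimState P.Q =>
      ((v, [Z], (none, none)) :
        SimState P.Q × List (SimSymbol P.Q P.Θ) × (Option γ × Option β))).Finite :=
    Set.finite_range _
  refine ((((h1.union h2).union h3).union h4).union h5).subset ?_
  intro v hv
  cases hv with
  | giveUp => exact .inr ⟨_, rfl⟩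
  | sym _ hδ =>
    exact .inl (.inl (.inl (.inl (Set.mem_iUnion₂.2 ⟨_, _, _, hδ, rfl⟩))))
  | bot _ hδ => exact .inl (.inl (.inl (.inr (Set.mem_iUnion.2 ⟨_, _, hδ, rfl⟩))))
  | ask => exact .inl (.inl (.inr ⟨(_, _), rfl⟩))
  | yes => exact .inl (.inr ⟨_, rfl⟩)
  | no => exact .inl (.inr ⟨_, rfl⟩)

/-- The oracle pushdown automaton that simulates `P`. -/
abbrev toOracleNPDA (P : Prog σ γ β) : OracleNPDA σ γ β where
  Q := SimState P.Q
  Θ := SimSymbol P.Q P.Θ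
  finite_Q := have := P.finite_Q; inferInstance
  finite_Θ := have := P.finite_Q; have := P.finite_Θ; inferInstance
  δ s a Z := {v | SimMove P s a Z v}
  finite_δ := P.finite_simMove
  q₀ := .run P.q₀
  Z₀ := .bot
  acc := SimState.run '' P.acc
  rej := {.rej}
  disjoint_acc_rej := by simp
  qQuery := .query
  qYes := .yes
  qNo := .no
  query_ne_yes := by simp
  query_ne_no := by simp
  yes_ne_no := by simp
  query_not_halt := by simp
  yes_not_halt := by simp
  no_not_halt := by simp

/-- The stack of the simulating automaton. -/
def simStack (P : Prog σ γ β) (s : List P.Θ) : List (SimSymbol P.Q P.Θ) :=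
  s.map .sym ++ [.bot]

/-- The configuration of the simulating automaton. -/
def simCfg (P : Prog σ γ β) (c : P.Cfg) : P.toOracleNPDA.OCfg :=
  ⟨⟨.run c.state, c.input, P.simStack c.stack⟩, c.query, c.output⟩

theorem mem_halt_iff (P : Prog σ γ β) (s : SimState P.Q) :
    s ∈ P.toOracleNPDA.toPDA.halt ↔ (∃ q ∈ P.acc, s = .run q) ∨ s = .rej := by
  constructor
  · rintro (⟨q, hq, rfl⟩ | h)
    · exact .inl ⟨q, hq, rfl⟩
    · exact .inr h
  · rintro (⟨q, hq, rfl⟩ | h)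
    · exact .inl ⟨q, hq, rfl⟩
    · exact .inr h

theorem reflTransGen_simCfg_of_step {P : Prog σ γ β} {A : Language β} {c d : P.Cfg}
    (h : P.Step A c d) :
    Relation.ReflTransGen (P.toOracleNPDA.Step A) (P.simCfg c) (P.simCfg d) := by
  cases h with
  | @move q i i' s y z a q' u w hacc hask hi hδ =>
    refine .single (OracleNPDA.Step.move (M := P.toOracleNPDA) _ _ _ _ w
      (fun h => by cases h) ⟨?_, ?_⟩)
    · rw [mem_halt_iff]; simpa using hacc
    · cases s with
      | nil => exact ⟨a, .bot, _, [], hi, rfl, by simp [simStack], .bot hask hδ⟩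
      | cons Z s =>
        exact ⟨a, .sym Z, _, P.simStack s, hi, rfl, by simp [simStack], .sym hask hδ⟩
  | @ask q i s y z r b hacc hask hb =>
    obtain ⟨Z, t, hZ⟩ : ∃ Z t, P.simStack s = Z :: t := by
      cases s <;> exact ⟨_, _, rfl⟩
    have h1 : P.toOracleNPDA.Step A (P.simCfg ⟨q, i, s, y, z⟩)
        ⟨⟨.query, i, .ret q :: P.simStack s⟩, y, z⟩ := by
      have := OracleNPDA.Step.move (M := P.toOracleNPDA) (A := A)
        ⟨.run q, i, P.simStack s⟩ ⟨.query, i, .ret q :: P.simStack s⟩ y z (none, none)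
        (fun h => by cases h)
        ⟨fun hh => hacc (by simpa using (P.mem_halt_iff _).1 hh),
          none, Z, [.ret q, Z], t, rfl, hZ, by rw [hZ]; rfl, .ask Z hask⟩
      simpa [simCfg] using this
    have hans : ∀ v : SimState P.Q, v ≠ .query → v ∉ P.toOracleNPDA.toPDA.halt →
        SimMove P v none (.ret q) (.run (r b), [], (none, none)) →
        P.toOracleNPDA.Step A ⟨⟨v, i, .ret q :: P.simStack s⟩, [], z⟩
          (P.simCfg ⟨r b, i, s, [], z⟩) := by
      intro v hv hv' hm
      have := OracleNPDA.Step.move (M := P.toOracleNPDA) (A := A)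
        ⟨v, i, .ret q :: P.simStack s⟩ ⟨.run (r b), i, P.simStack s⟩ [] z (none, none)
        hv ⟨hv', none, .ret q, [], P.simStack s, rfl, rfl, rfl, hm⟩
      simpa [simCfg] using this
    refine .trans (.single h1) ?_
    cases b with
    | true =>
      exact .trans (.single (.yes _ _ _ rfl (hb.1 rfl)))
        (.single (hans .yes (by simp) (fun h => by simpa using (P.mem_halt_iff _).1 h) (.yes hask)))
    | false =>
      exact .trans (.single (.no _ _ _ rfl (by simpa using hb)))
        (.single (hans .no (by simp) (fun h => by simpa using (P.mem_halt_iff _).1 h) (.no hask)))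

/-- What is known about a configuration that the simulating automaton reaches in `n` steps. -/
inductive SimInv (P : Prog σ γ β) (A : Language β) (x : List σ) :
    ℕ → P.toOracleNPDA.OCfg → Prop
  | run {n m : ℕ} {c : P.Cfg} (h : Steps (P.Step A) m (P.start x) c) (hn : n ≤ 3 * m) :
      SimInv P A x n (P.simCfg c)
  | query {n m : ℕ} {c : P.Cfg} {r : Bool → P.Q} (h : Steps (P.Step A) m (P.start x) c)
      (hacc : c.state ∉ P.acc) (hask : P.ask c.state = some r) (hn : n ≤ 3 * m + 1) :
      SimInv P A x n ⟨⟨.query, c.input, .ret c.state :: P.simStack c.stack⟩, c.query, c.output⟩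
  | answer {n m : ℕ} {c : P.Cfg} {r : Bool → P.Q} (b : Bool)
      (h : Steps (P.Step A) m (P.start x) c)
      (hacc : c.state ∉ P.acc) (hask : P.ask c.state = some r) (hb : b = true ↔ c.query ∈ A)
      (hn : n ≤ 3 * m + 2) :
      SimInv P A x n ⟨⟨if b then .yes else .no, c.input, .ret c.state :: P.simStack c.stack⟩,
        [], c.output⟩
  | rej {n m : ℕ} {c : P.Cfg} {C : P.toOracleNPDA.OCfg} (h : Steps (P.Step A) m (P.start x) c)
      (hC : C.cfg.state = .rej) (hn : n ≤ 3 * m + 3) : SimInv P A x n C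

/-- A program move costs one step and a query three: save the state, query, restore. Giving up costs
one more. This accounts for `3 * m` and the offsets 1, 2, 3 in the invariant. -/
theorem SimInv.step {P : Prog σ γ β} {A : Language β} {x : List σ} {n : ℕ}
    {C D : P.toOracleNPDA.OCfg} (hC : SimInv P A x n C) (hs : P.toOracleNPDA.Step A C D) :
    SimInv P A x (n + 1) D := by
  cases hC with
  | @run m c h hn =>
    obtain ⟨q, i, s, y, z⟩ := c
    generalize hE : P.simCfg ⟨q, i, s, y, z⟩ = E at hs
    cases hs with
    | move c' d y z w hq hm =>
      simp only [simCfg, OracleNPDA.OCfg.mk.injEq] at hE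
      obtain ⟨rfl, rfl, rfl⟩ := hE
      obtain ⟨hh, a, Z, u, t, hi, hst, hu, hδ⟩ := hm
      obtain ⟨q', i', t'⟩ := d
      dsimp only at hi hst hu hδ
      subst hu
      change SimMove P (.run q) a Z (q', u, w) at hδ
      have hacc : q ∉ P.acc := fun hq => hh ((P.mem_halt_iff _).2 (.inl ⟨q, hq, rfl⟩))
      cases hδ with
      | giveUp => exact .rej h rfl (by omega)
      | @sym _ _ Z q' u w hask hδ =>
        cases s with
        | nil => simp [simStack] at hst
        | cons Z' s =>
          simp only [simStack, List.map_cons, List.cons_append, List.cons.injEq,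
            SimSymbol.sym.injEq] at hst
          obtain ⟨rfl, rfl⟩ := hst
          have := SimInv.run (n := n + 1) (h.tail (.move hacc hask hi hδ)) (by omega)
          simpa [simCfg, simStack] using this
      | @bot _ _ q' u w hask hδ =>
        cases s with
        | cons => simp [simStack] at hst
        | nil =>
          simp only [simStack, List.map_nil, List.nil_append, List.cons.injEq, true_and] at hst
          subst hst
          have := SimInv.run (n := n + 1) (h.tail (.move hacc hask hi hδ)) (by omega)
          simpa [simCfg, simStack] using this
      | ask Z hask =>
        have := SimInv.query (n := n + 1) h hacc hask (by omega)
        dsimp only at this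
        rw [hst] at this
        simp only [Option.toList_none, List.nil_append] at hi
        subst hi
        simpa using this
    | yes c' y z hq =>
      simp only [simCfg, OracleNPDA.OCfg.mk.injEq] at hE
      rw [← hE.1] at hq
      cases hq
    | no c' y z hq =>
      simp only [simCfg, OracleNPDA.OCfg.mk.injEq] at hE
      rw [← hE.1] at hq
      cases hq
  | @query m c r h hacc hask hn =>
    cases hs with
    | move _ d y z w hq hm => exact absurd rfl hq
    | yes _ y z hq hy => exact .answer true h hacc hask (by simpa using hy) (by omega)
    | no _ y z hq hy => exact .answer false h hacc hask (by simpa using hy) (by omega)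
  | @answer m c r b h hacc hask hb hn =>
    obtain ⟨q, i, s, y, z⟩ := c
    have hvq : (if b then SimState.yes else SimState.no : SimState P.Q) ≠ .query := by
      cases b <;> simp
    cases hs with
    | yes _ y z hq hy => exact absurd hq hvq
    | no _ y z hq hy => exact absurd hq hvq
    | move _ d _ z w hq hm =>
      obtain ⟨hh, a, Z, u, t, hi, hst, hu, hδ⟩ := hm
      obtain ⟨q', i', t'⟩ := d
      dsimp only at hi hst hu hδ hask hb
      subst hu
      change SimMove P (if b then SimState.yes else SimState.no) a Z (q', u, w) at hδ
      simp only [List.cons.injEq] at hst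
      obtain ⟨rfl, rfl⟩ := hst
      have hrun := SimInv.run (n := n + 1) (h.tail (.ask b hacc hask hb)) (by omega)
      cases b <;> cases hδ
      case false.giveUp => exact .rej h rfl (by omega)
      case true.giveUp => exact .rej h rfl (by omega)
      all_goals
        rename_i r' hask'
        obtain rfl : r = r' := by rw [hask] at hask'; exact Option.some.inj hask'
        simp only [Option.toList_none, List.nil_append] at hi
        subst hi
        simpa [simCfg] using hrun
  | @rej m c C h hC hn =>
    exfalso
    cases hs with
    | move _ d y z w hq hm => exact hm.1 ((P.mem_halt_iff _).2 (.inr hC))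
    | yes _ y z hq hy => rw [hq] at hC; cases hC
    | no _ y z hq hy => rw [hq] at hC; cases hC

theorem SimInv.of_steps {P : Prog σ γ β} {A : Language β} {x : List σ} {n : ℕ}
    {C : P.toOracleNPDA.OCfg} (h : Steps (P.toOracleNPDA.Step A) n (P.toOracleNPDA.start x) C) :
    SimInv P A x n C := by
  generalize hs : P.toOracleNPDA.start x = S at h
  induction h with
  | refl => subst hs; exact SimInv.run (c := P.start x) (.refl _) (by omega)
  | tail _ h ih => exact (ih hs).step h

/-- The bottom marker is never removed, so the stack is nonempty and giving up is possible, except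
in the query state, where the oracle provides the successor. -/
theorem SimInv.halted_or_step {P : Prog σ γ β} {A : Language β} {x : List σ} {n : ℕ}
    {C : P.toOracleNPDA.OCfg} (h : SimInv P A x n C) :
    C.cfg.state ∈ P.toOracleNPDA.toPDA.halt ∨ ∃ D, P.toOracleNPDA.Step A C D := by
  by_cases hh : C.cfg.state ∈ P.toOracleNPDA.toPDA.halt
  · exact .inl hh
  right
  by_cases hq : C.cfg.state = .query
  · by_cases hy : C.query ∈ A
    · exact ⟨_, .yes _ _ _ hq hy⟩
    · exact ⟨_, .no _ _ _ hq hy⟩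
  have hne : ∃ Z t, C.cfg.stack = Z :: t := by
    cases h with
    | @run m c =>
      obtain ⟨q, i, s, y, z⟩ := c
      cases s <;> exact ⟨_, _, rfl⟩
    | query => exact ⟨_, _, rfl⟩
    | answer => exact ⟨_, _, rfl⟩
    | rej _ hC => exact absurd ((P.mem_halt_iff _).2 (.inr hC)) hh
  obtain ⟨Z, t, hst⟩ := hne
  exact ⟨_, OracleNPDA.Step.move (M := P.toOracleNPDA) C.cfg ⟨.rej, C.cfg.input, C.cfg.stack⟩
    C.query C.output (none, none) hq
    ⟨hh, none, Z, [Z], t, rfl, hst, hst, .giveUp _ _⟩⟩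

theorem toOracleNPDA_linearTime {P : Prog σ γ β} (hP : P.Bounded) :
    P.toOracleNPDA.LinearTime := by
  obtain ⟨a, b, hb⟩ := hP
  refine ⟨3 * a, 3 * b + 3, fun A x => HaltsWithin.of_bounded _ _ (fun n C h => ?_)
    fun n C h => (SimInv.of_steps h).halted_or_step⟩
  have key : ∃ m c, Steps (P.Step A) m (P.start x) c ∧ n ≤ 3 * m + 3 := by
    cases SimInv.of_steps h with
    | run h' hn => exact ⟨_, _, h', by omega⟩
    | query h' _ _ hn => exact ⟨_, _, h', by omega⟩
    | answer _ h' _ _ _ hn => exact ⟨_, _, h', by omega⟩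
    | rej h' _ hn => exact ⟨_, _, h', hn⟩
  obtain ⟨m, c, hm, hn⟩ := key
  have := hb A x m c hm
  nlinarith

theorem toOracleNPDA_outputs (P : Prog σ γ β) (A : Language β) (x : List σ) :
    P.toOracleNPDA.outputs A x = P.outputs A x := by
  ext z
  constructor
  · rintro ⟨C, ⟨q, hq, hqC⟩, rfl, h⟩
    obtain ⟨n, h⟩ := Steps.exists_of_reflTransGen h
    cases SimInv.of_steps h with
    | run h' hn =>
      cases hqC
      exact ⟨_, hq, rfl, h'.reflTransGen⟩
    | query => cases hqC
    | answer b => cases b <;> cases hqC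
    | rej h hC => rw [hC] at hqC; cases hqC
  · rintro ⟨c, hc, rfl, h⟩
    refine ⟨P.simCfg c, ⟨_, hc, rfl⟩, rfl, ?_⟩
    have : ∀ d, Relation.ReflTransGen (P.Step A) (P.start x) d →
        Relation.ReflTransGen (P.toOracleNPDA.Step A) (P.simCfg (P.start x)) (P.simCfg d) := by
      intro d hd
      induction hd with
      | refl => exact .refl
      | tail _ h ih => exact ih.trans (reflTransGen_simCfg_of_step h)
    exact this c h

end Prog

theorem OracleNPDA.accepts_iff {σ γ β : Type} (M : OracleNPDA σ γ β) (A : Language β)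
    (x : List σ) : M.Accepts A x ↔ (M.outputs A x).Nonempty :=
  ⟨fun ⟨c, hc, h⟩ => ⟨_, c, hc, rfl, h⟩, fun ⟨_, c, hc, _, h⟩ => ⟨c, hc, h⟩⟩

/-! ### Computation paths as words -/

namespace OracleNPDA

variable {σ γ β : Type}

/-- The transitions of an oracle pushdown automaton. -/
@[ext]
structure Instr (M : OracleNPDA σ γ β) : Type where
  src : M.Q
  read : Option (TapeSymbol σ)
  top : M.Θ
  dst : M.Q
  push : List M.Θ
  out : Option γ
  qry : Option β
  mem : (dst, push, (out, qry)) ∈ M.δ src read top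

instance [Finite σ] (M : OracleNPDA σ γ β) : Finite M.Instr := by
  have := M.finite_Q
  have := M.finite_Θ
  have : ∀ k : M.Q × Option (TapeSymbol σ) × M.Θ, Finite (M.δ k.1 k.2.1 k.2.2) :=
    fun k => M.finite_δ _ _ _
  refine Finite.of_injective
    (β := Σ k : M.Q × Option (TapeSymbol σ) × M.Θ, M.δ k.1 k.2.1 k.2.2)
    (fun t => ⟨(t.src, t.read, t.top), ⟨_, t.mem⟩⟩) ?_
  rintro ⟨a, b, c, d, e, f, g, h⟩ ⟨a', b', c', d', e', f', g', h'⟩ heq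
  simp only [Sigma.mk.injEq, Prod.mk.injEq] at heq
  obtain ⟨⟨rfl, rfl, rfl⟩, heq⟩ := heq
  simp only [heq_eq_eq, Subtype.mk.injEq, Prod.mk.injEq] at heq
  obtain ⟨rfl, rfl, rfl, rfl⟩ := heq
  rfl

/-- A step of a computation path is a transition or an answer of the oracle. -/
abbrev Label (M : OracleNPDA σ γ β) : Type := M.Instr ⊕ Bool

/-- The tape symbol that a step reads. -/
def labelRead {M : OracleNPDA σ γ β} : M.Label → Option (TapeSymbol σ) :=
  Sum.elim Instr.read fun _ => none

/-- The output symbol that a step writes. -/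
def labelOut {M : OracleNPDA σ γ β} : M.Label → Option γ :=
  Sum.elim Instr.out fun _ => none

/-- The tape symbols read along a path. -/
def reads {M : OracleNPDA σ γ β} (p : List M.Label) : List (TapeSymbol σ) :=
  p.flatMap fun l => (labelRead l).toList

/-- The output symbols written along a path. -/
def outs {M : OracleNPDA σ γ β} (p : List M.Label) : List γ :=
  p.flatMap fun l => (labelOut l).toList

/-- The transition does not start at a halting state or the query state. -/
def Enabled {M : OracleNPDA σ γ β} (t : M.Instr) : Prop :=
  t.src ∉ M.toPDA.halt ∧ t.src ≠ M.qQuery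

/-- The state after the oracle answer `b`. -/
def answerState (M : OracleNPDA σ γ β) (b : Bool) : M.Q := if b then M.qYes else M.qNo

/-- A configuration without the input tape and the output tape. -/
structure Core (M : OracleNPDA σ γ β) : Type where
  state : M.Q
  stack : List M.Θ
  query : List β

/-- The initial core configuration. -/
def coreStart (M : OracleNPDA σ γ β) : M.Core := ⟨M.q₀, [M.Z₀], []⟩

/-- The effect of a labelled step on the core configuration. -/
inductive LStep (M : OracleNPDA σ γ β) (A : Language β) : M.Core → M.Label → M.Core → Prop
  | instr (t : M.Instr) (s : List M.Θ) (y : List β) (ht : Enabled t) :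
      LStep M A ⟨t.src, t.top :: s, y⟩ (.inl t) ⟨t.dst, t.push ++ s, y ++ t.qry.toList⟩
  | answer (b : Bool) (s : List M.Θ) (y : List β) (hb : b = true ↔ y ∈ A) :
      LStep M A ⟨M.qQuery, s, y⟩ (.inr b) ⟨M.answerState b, s, []⟩

/-- `M.Run A c p d`: the path `p` leads from `c` to `d`. -/
inductive Run (M : OracleNPDA σ γ β) (A : Language β) : M.Core → List M.Label → M.Core → Prop
  | nil (c : M.Core) : Run M A c [] c
  | cons {c d e : M.Core} {l : M.Label} {p : List M.Label} (h : M.LStep A c l d)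
      (hp : Run M A d p e) : Run M A c (l :: p) e

variable {M : OracleNPDA σ γ β} {A : Language β}

@[simp] theorem reads_nil : reads ([] : List M.Label) = [] := rfl

@[simp] theorem reads_cons (l : M.Label) (p : List M.Label) :
    reads (l :: p) = (labelRead l).toList ++ reads p := List.flatMap_cons

@[simp] theorem reads_append (p p' : List M.Label) : reads (p ++ p') = reads p ++ reads p' :=
  List.flatMap_append

@[simp] theorem outs_nil : outs ([] : List M.Label) = [] := rfl

@[simp] theorem outs_cons (l : M.Label) (p : List M.Label) :
    outs (l :: p) = (labelOut l).toList ++ outs p := List.flatMap_cons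

@[simp] theorem labelRead_inl (t : M.Instr) : labelRead (.inl t : M.Label) = t.read := rfl
@[simp] theorem labelRead_inr (b : Bool) : labelRead (.inr b : M.Label) = none := rfl
@[simp] theorem labelOut_inl (t : M.Instr) : labelOut (.inl t : M.Label) = t.out := rfl
@[simp] theorem labelOut_inr (b : Bool) : labelOut (.inr b : M.Label) = none := rfl

theorem Run.append {c d e : M.Core} {p p' : List M.Label} (h : M.Run A c p d)
    (h' : M.Run A d p' e) : M.Run A c (p ++ p') e := by
  induction h with
  | nil => exact h'
  | cons hl _ ih => exact .cons hl (ih h')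

theorem Run.snoc {c d e : M.Core} {p : List M.Label} {l : M.Label} (h : M.Run A c p d)
    (h' : M.LStep A d l e) : M.Run A c (p ++ [l]) e :=
  h.append (.cons h' (.nil _))

theorem Run.of_append {c e : M.Core} {p p' : List M.Label} (h : M.Run A c (p ++ p') e) :
    ∃ d, M.Run A c p d ∧ M.Run A d p' e := by
  induction p generalizing c with
  | nil => exact ⟨c, .nil _, h⟩
  | cons l p ih =>
    cases h with
    | cons hl hp =>
      obtain ⟨d, h1, h2⟩ := ih hp
      exact ⟨d, .cons hl h1, h2⟩

theorem LStep.instr_inv {c d : M.Core} {t : M.Instr} (h : M.LStep A c (.inl t) d) :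
    Enabled t ∧ c.state = t.src ∧ ∃ s, c.stack = t.top :: s ∧
      d = ⟨t.dst, t.push ++ s, c.query ++ t.qry.toList⟩ := by
  cases h with
  | instr t s y ht => exact ⟨ht, rfl, s, rfl, rfl⟩

theorem LStep.answer_inv {c d : M.Core} {b : Bool} (h : M.LStep A c (.inr b) d) :
    (b = true ↔ c.query ∈ A) ∧ c.state = M.qQuery ∧ d = ⟨M.answerState b, c.stack, []⟩ := by
  cases h with
  | answer b s y hb => exact ⟨hb, rfl, rfl⟩

/-- A label records the whole nondeterministic choice, including the pushed word, so a path is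
determined by its labels. -/
theorem LStep.det {c d d' : M.Core} {l : M.Label} (h : M.LStep A c l d) (h' : M.LStep A c l d') :
    d = d' := by
  rcases l with t | b
  · obtain ⟨_, _, s, h1, rfl⟩ := h.instr_inv
    obtain ⟨_, _, s', h2, rfl⟩ := h'.instr_inv
    obtain rfl : s = s' := (List.cons.inj (h1.symm.trans h2)).2
    rfl
  · rw [h.answer_inv.2.2, h'.answer_inv.2.2]

theorem Run.det {c d d' : M.Core} {p : List M.Label} (h : M.Run A c p d)
    (h' : M.Run A c p d') : d = d' := by
  induction h with
  | nil => cases h'; rfl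
  | cons hl _ ih =>
    cases h' with
    | cons hl' hp' => exact ih (by rwa [hl.det hl'])

theorem LStep.not_halt {c d : M.Core} {l : M.Label} (h : M.LStep A c l d) :
    c.state ∉ M.toPDA.halt := by
  cases h with
  | instr t s y ht => exact ht.1
  | answer => exact M.query_not_halt

/-- The full configuration with given unread input and output. -/
def Core.full (c : M.Core) (i : List (TapeSymbol σ)) (z : List γ) : M.OCfg :=
  ⟨⟨c.state, i, c.stack⟩, c.query, z⟩

theorem LStep.step {c d : M.Core} {l : M.Label} (h : M.LStep A c l d)
    (i : List (TapeSymbol σ)) (z : List γ) :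
    M.Step A (c.full ((labelRead l).toList ++ i) z) (d.full i (z ++ (labelOut l).toList)) := by
  cases h with
  | instr t s y ht =>
    exact .move _ ⟨t.dst, i, t.push ++ s⟩ _ _ (t.out, t.qry) ht.2
      ⟨ht.1, t.read, t.top, t.push, s, rfl, rfl, rfl, t.mem⟩
  | answer b s y hb =>
    simp only [labelRead_inr, Option.toList_none, List.nil_append, labelOut_inr, List.append_nil]
    cases b with
    | true => exact .yes _ _ _ rfl (hb.1 rfl)
    | false => exact .no _ _ _ rfl (by simpa using hb)

theorem exists_lStep_of_step {C D : M.OCfg} (h : M.Step A C D) :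
    ∃ l, M.LStep A ⟨C.cfg.state, C.cfg.stack, C.query⟩ l ⟨D.cfg.state, D.cfg.stack, D.query⟩ ∧
      C.cfg.input = (labelRead l).toList ++ D.cfg.input ∧
      D.output = C.output ++ (labelOut l).toList := by
  cases h with
  | move c d y z w hq hm =>
    obtain ⟨hh, a, Z, u, s, hi, hs, hu, hδ⟩ := hm
    obtain ⟨q, i, s'⟩ := c
    obtain ⟨q', i', s''⟩ := d
    dsimp only at *
    subst hs hu
    exact ⟨.inl ⟨q, a, Z, q', u, w.1, w.2, hδ⟩, .instr ⟨q, a, Z, q', u, w.1, w.2, hδ⟩ s y ⟨hh, hq⟩,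
      hi, rfl⟩
  | yes c y z hq hy =>
    obtain ⟨q, i, s'⟩ := c
    dsimp only at *
    subst hq
    exact ⟨.inr true, .answer true s' y (by simpa using hy), rfl, (List.append_nil _).symm⟩
  | no c y z hq hy =>
    obtain ⟨q, i, s'⟩ := c
    dsimp only at *
    subst hq
    exact ⟨.inr false, .answer false s' y (by simpa using hy), rfl, (List.append_nil _).symm⟩

theorem Run.steps {c d : M.Core} {p : List M.Label} (h : M.Run A c p d)
    (i : List (TapeSymbol σ)) (z : List γ) :
    Steps (M.Step A) p.length (c.full (reads p ++ i) z) (d.full i (z ++ outs p)) := by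
  induction h generalizing z with
  | nil => simpa using .refl _
  | cons hl _ ih =>
    have := (ih (z ++ (labelOut _).toList)).head (hl.step _ z)
    simpa [List.append_assoc] using this

theorem exists_run_of_reflTransGen {C D : M.OCfg} (h : Relation.ReflTransGen (M.Step A) C D) :
    ∃ p, M.Run A ⟨C.cfg.state, C.cfg.stack, C.query⟩ p ⟨D.cfg.state, D.cfg.stack, D.query⟩ ∧
      C.cfg.input = reads p ++ D.cfg.input ∧ D.output = C.output ++ outs p := by
  induction h using Relation.ReflTransGen.head_induction_on with
  | refl => exact ⟨[], .nil _, rfl, (List.append_nil _).symm⟩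
  | head h _ ih =>
    obtain ⟨l, h1, h2, h3⟩ := exists_lStep_of_step h
    obtain ⟨p, h4, h5, h6⟩ := ih
    exact ⟨l :: p, .cons h1 h4, by simp [h2, h5], by simp [h6, h3]⟩

/-- `p` is an accepting computation path on `x` that leaves `r` unread. -/
def AccPath (M : OracleNPDA σ γ β) (A : Language β) (x : List σ) (p : List M.Label)
    (r : List (TapeSymbol σ)) : Prop :=
  ∃ d, M.Run A M.coreStart p d ∧ d.state ∈ M.acc ∧ reads p ++ r = inputTape x

theorem mem_outputs_iff {x : List σ} {z : List γ} :
    z ∈ M.outputs A x ↔ ∃ p r, M.AccPath A x p r ∧ outs p = z := by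
  constructor
  · rintro ⟨C, hC, rfl, h⟩
    obtain ⟨p, h1, h2, h3⟩ := exists_run_of_reflTransGen h
    exact ⟨p, C.cfg.input, ⟨_, h1, hC, h2.symm⟩, h3.symm⟩
  · rintro ⟨p, r, ⟨d, h1, h2, h3⟩, rfl⟩
    refine ⟨d.full r (outs p), h2, rfl, ?_⟩
    have := (h1.steps r []).reflTransGen
    rw [h3] at this
    exact this

/-- Accepting states halt, so an accepting path has no proper extension. -/
theorem eq_of_accPath_of_isPrefix {x : List σ} {p p' : List M.Label} {r r' : List (TapeSymbol σ)}
    (h : M.AccPath A x p r) (h' : M.AccPath A x p' r') (hp : p <+: p') : p = p' := by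
  obtain ⟨d, h1, h2, _⟩ := h
  obtain ⟨d', h1', _, _⟩ := h'
  obtain ⟨p'', rfl⟩ := hp
  obtain ⟨e, h3, h4⟩ := h1'.of_append
  obtain rfl := h1.det h3
  cases h4 with
  | nil => simp
  | cons hl _ => exact absurd (.inl h2) hl.not_halt

/-- The length of a path is linear in the number of symbols that it reads, provided that they
form a prefix of an input tape. -/
theorem Run.length_le {a b : ℕ}
    (hM : ∀ (A : Language β) (x : List σ), HaltsWithin (M.Step A)
      (fun c => c.cfg.state ∈ M.toPDA.halt) (a * x.length + b) (M.start x))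
    {p : List M.Label} {d : M.Core} (h : M.Run A M.coreStart p d) {x : List σ}
    (hx : reads p <+: inputTape x) : p.length ≤ a * x.length + b := by
  obtain ⟨i, hi⟩ := hx
  have hs := h.steps i []
  rw [hi] at hs
  refine HaltsWithin.steps_le ?_ (hM A x) hs
  intro c d hc hs
  obtain ⟨l, hl, _⟩ := exists_lStep_of_step hs
  exact hl.not_halt hc

end OracleNPDA

/-! ### The format of the input tape -/

/-- States of a finite automaton that checks the format of an input tape. -/
inductive Fmt : Type
  | start
  | mid
  | fin
  | bad

instance : Finite Fmt :=
  Finite.of_surjective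
    (fun o : Fin 4 => match o with
      | 0 => Fmt.start
      | 1 => .mid
      | 2 => .fin
      | 3 => .bad)
    (by rintro (_ | _ | _ | _)
        exacts [⟨0, rfl⟩, ⟨1, rfl⟩, ⟨2, rfl⟩, ⟨3, rfl⟩])

namespace Fmt

variable {σ : Type}

/-- The transition function of the format checker. -/
def step : Fmt → TapeSymbol σ → Fmt
  | start, .leftEnd => mid
  | mid, .letter _ => mid
  | mid, .rightEnd => fin
  | _, _ => bad

/-- The state after a word, from a given state. -/
def evalFrom (f : Fmt) (v : List (TapeSymbol σ)) : Fmt := v.foldl step f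

@[simp] theorem evalFrom_nil (f : Fmt) : f.evalFrom ([] : List (TapeSymbol σ)) = f := rfl

theorem evalFrom_append (f : Fmt) (v w : List (TapeSymbol σ)) :
    f.evalFrom (v ++ w) = (f.evalFrom v).evalFrom w := List.foldl_append

@[simp] theorem bad_evalFrom (v : List (TapeSymbol σ)) : bad.evalFrom v = bad := by
  induction v with
  | nil => rfl
  | cons s v ih => exact ih

theorem evalFrom_ne_bad_of_append {f : Fmt} {v w : List (TapeSymbol σ)}
    (h : f.evalFrom (v ++ w) ≠ bad) : f.evalFrom v ≠ bad := by
  intro h'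
  rw [evalFrom_append, h', bad_evalFrom] at h
  exact h rfl

theorem fin_evalFrom_cons (s : TapeSymbol σ) (v : List (TapeSymbol σ)) :
    fin.evalFrom (s :: v) = bad := by
  cases s <;> exact bad_evalFrom v

theorem mid_evalFrom_inputTape (x : List σ) :
    mid.evalFrom (x.map TapeSymbol.letter ++ [TapeSymbol.rightEnd]) = fin := by
  induction x with
  | nil => rfl
  | cons a x ih => exact ih

theorem start_evalFrom_inputTape (x : List σ) : start.evalFrom (inputTape x) = fin :=
  mid_evalFrom_inputTape x

theorem evalFrom_ne_bad_of_isPrefix {v : List (TapeSymbol σ)} {x : List σ}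
    (h : v <+: inputTape x) : start.evalFrom v ≠ bad := by
  obtain ⟨w, hw⟩ := h
  refine evalFrom_ne_bad_of_append (w := w) ?_
  rw [hw, start_evalFrom_inputTape]
  exact fun h => by cases h

theorem eq_inputTape_of_evalFrom_eq_fin {v : List (TapeSymbol σ)} {x : List σ}
    (h : v <+: inputTape x) (hv : start.evalFrom v = fin) : v = inputTape x := by
  obtain ⟨w, hw⟩ := h
  cases w with
  | nil => simpa using hw
  | cons s w =>
    have := start_evalFrom_inputTape x
    rw [← hw, evalFrom_append, hv, fin_evalFrom_cons] at this
    cases this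

theorem exists_of_mid_evalFrom : ∀ {v : List (TapeSymbol σ)}, mid.evalFrom v ≠ bad →
    ∃ x : List σ, v <+: x.map TapeSymbol.letter ++ [TapeSymbol.rightEnd] ∧ x.length ≤ v.length
  | [], _ => ⟨[], by simp, le_rfl⟩
  | .leftEnd :: v, h => absurd (bad_evalFrom v) h
  | .rightEnd :: [], _ => ⟨[], by simp, by simp⟩
  | .rightEnd :: s :: v, h => absurd (fin_evalFrom_cons s v) h
  | .letter a :: v, h => by
    obtain ⟨x, hx, hl⟩ := exists_of_mid_evalFrom (v := v) h
    exact ⟨a :: x, by simpa using hx, by simpa using hl⟩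

/-- Produces a genuine input, no longer than the word, to which the time bound of the machine can be
applied. -/
theorem exists_prefix_inputTape : ∀ {v : List (TapeSymbol σ)}, start.evalFrom v ≠ bad →
    ∃ x : List σ, v <+: inputTape x ∧ x.length ≤ v.length
  | [], _ => ⟨[], by simp, le_rfl⟩
  | .rightEnd :: v, h => absurd (bad_evalFrom v) h
  | .letter _ :: v, h => absurd (bad_evalFrom v) h
  | .leftEnd :: v, h => by
    obtain ⟨x, hx, hl⟩ := exists_of_mid_evalFrom (v := v) h
    exact ⟨x, by simpa [inputTape] using hx, by simp; omega⟩

end Fmt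

namespace OracleNPDA

variable {σ γ β : Type}

/-! ### Encoded computation paths -/

/-- A computation path is encoded by its labels, followed by the tape symbols left unread. -/
abbrev PathSymbol (M : OracleNPDA σ γ β) : Type := M.Label ⊕ TapeSymbol σ

/-- The tape symbol that belongs to a symbol of an encoded path. -/
def symRead {M : OracleNPDA σ γ β} : M.PathSymbol → Option (TapeSymbol σ) :=
  Sum.elim labelRead some

/-- The output symbol that belongs to a symbol of an encoded path. -/
def symOut {M : OracleNPDA σ γ β} : M.PathSymbol → Option γ :=
  Sum.elim labelOut fun _ => none

/-- The tape symbols in an encoded path. -/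
def symReads {M : OracleNPDA σ γ β} (z : List M.PathSymbol) : List (TapeSymbol σ) :=
  z.flatMap fun k => (symRead k).toList

/-- The output symbols in an encoded path. -/
def symOuts {M : OracleNPDA σ γ β} (z : List M.PathSymbol) : List γ :=
  z.flatMap fun k => (symOut k).toList

/-- The encoding of the path `p` that leaves `r` unread. -/
def encode {M : OracleNPDA σ γ β} (p : List M.Label) (r : List (TapeSymbol σ)) :
    List M.PathSymbol :=
  p.map .inl ++ r.map .inr

variable {M : OracleNPDA σ γ β} {A : Language β}

@[simp] theorem symRead_inl (l : M.Label) : symRead (.inl l : M.PathSymbol) = labelRead l := rfl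
@[simp] theorem symRead_inr (s : TapeSymbol σ) : symRead (.inr s : M.PathSymbol) = some s := rfl
@[simp] theorem symOut_inl (l : M.Label) : symOut (.inl l : M.PathSymbol) = labelOut l := rfl
@[simp] theorem symOut_inr (s : TapeSymbol σ) : symOut (.inr s : M.PathSymbol) = none := rfl

@[simp] theorem symReads_nil : symReads ([] : List M.PathSymbol) = [] := rfl

@[simp] theorem symReads_cons (k : M.PathSymbol) (z : List M.PathSymbol) :
    symReads (k :: z) = (symRead k).toList ++ symReads z := List.flatMap_cons

@[simp] theorem symReads_append (z z' : List M.PathSymbol) :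
    symReads (z ++ z') = symReads z ++ symReads z' := List.flatMap_append

@[simp] theorem symOuts_nil : symOuts ([] : List M.PathSymbol) = [] := rfl

@[simp] theorem symOuts_cons (k : M.PathSymbol) (z : List M.PathSymbol) :
    symOuts (k :: z) = (symOut k).toList ++ symOuts z := List.flatMap_cons

@[simp] theorem symReads_map_inl (p : List M.Label) :
    symReads (p.map .inl : List M.PathSymbol) = reads p := by
  induction p with
  | nil => rfl
  | cons l p ih => simp [ih]

@[simp] theorem symReads_map_inr (r : List (TapeSymbol σ)) :
    symReads (r.map .inr : List M.PathSymbol) = r := by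
  induction r with
  | nil => rfl
  | cons s r ih => simp [ih]

theorem symReads_encode (p : List M.Label) (r : List (TapeSymbol σ)) :
    symReads (encode p r) = reads p ++ r := by
  simp [encode]

theorem symOuts_encode (p : List M.Label) (r : List (TapeSymbol σ)) :
    symOuts (encode p r) = outs p := by
  induction p with
  | nil =>
    induction r with
    | nil => rfl
    | cons s r ih => simpa [encode] using ih
  | cons l p ih => simpa [encode] using ih

theorem length_symReads_le (z : List M.PathSymbol) : (symReads z).length ≤ z.length := by
  induction z with
  | nil => simp
  | cons k z ih =>
    have : (symRead k).toList.length ≤ 1 := by cases symRead k <;> simp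
    simp only [symReads_cons, List.length_append, List.length_cons]
    omega

theorem encode_split {p p₀ : List M.Label} {w : List M.PathSymbol} {r₀ : List (TapeSymbol σ)}
    (h : p.map .inl ++ w = encode p₀ r₀) : ∃ p₁, p₀ = p ++ p₁ ∧ w = encode p₁ r₀ := by
  induction p generalizing p₀ with
  | nil => exact ⟨p₀, rfl, h⟩
  | cons l p ih =>
    cases p₀ with
    | nil =>
      cases r₀ <;> simp [encode] at h
    | cons l₀ p₀ =>
      simp only [encode, List.map_cons, List.cons_append, List.cons.injEq, Sum.inl.injEq] at h
      obtain ⟨rfl, h⟩ := h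
      obtain ⟨p₁, rfl, hw⟩ := ih h
      exact ⟨p₁, rfl, hw⟩

/-- In an encoding no label follows an unread tape symbol, so the `r` preceding `l` must be empty.
-/
theorem encode_split_label {p p₀ : List M.Label} {r r₀ : List (TapeSymbol σ)} {l : M.Label}
    {w : List M.PathSymbol} (h : encode p r ++ .inl l :: w = encode p₀ r₀) :
    ∃ p₁, p₀ = p ++ l :: p₁ := by
  obtain ⟨p₁, rfl, hw⟩ := encode_split ((List.append_assoc _ _ _).symm.trans h)
  clear h
  cases p₁ with
  | nil =>
    have : (Sum.inl l : M.PathSymbol) ∈ r₀.map Sum.inr := by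
      rw [show r₀.map Sum.inr = encode (M := M) [] r₀ from rfl, ← hw]
      simp
    simp at this
  | cons l₁ p₁ =>
    cases r with
    | nil =>
      simp only [encode, List.map_nil, List.nil_append, List.map_cons, List.cons_append,
        List.cons.injEq, Sum.inl.injEq] at hw
      obtain ⟨rfl, -⟩ := hw
      exact ⟨p₁, rfl⟩
    | cons s r => simp [encode] at hw

theorem encode_inj {p p₀ : List M.Label} {r r₀ : List (TapeSymbol σ)}
    (h : encode p r = encode p₀ r₀) : p₀ = p ∧ r₀ = r := by
  obtain ⟨p₁, rfl, h⟩ := encode_split h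
  cases p₁ with
  | nil =>
    refine ⟨by simp, ?_⟩
    have := congrArg symReads h
    simpa [symReads_encode] using this.symm
  | cons l₁ p₁ => cases r <;> simp [encode] at h

/-! ### The order of computation paths -/

/-- `p'` has the smaller label at the first position where `p'` and `p` differ. -/
def LexBelow (code : M.Label → ℕ) (p' p : List M.Label) : Prop :=
  ∃ c l₁ l₂ s₁ s₂, p' = c ++ l₁ :: s₁ ∧ p = c ++ l₂ :: s₂ ∧ code l₁ < code l₂

/-- `z` encodes the least accepting computation path on `x`. -/
def EncodesLeast (M : OracleNPDA σ γ β) (A : Language β) (code : M.Label → ℕ) (x : List σ)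
    (z : List M.PathSymbol) : Prop :=
  ∃ p r, z = encode p r ∧ M.AccPath A x p r ∧
    ∀ p₁ r₁, M.AccPath A x p₁ r₁ → ¬ LexBelow code p₁ p

/-! ### Recognizing the words that do not encode a least accepting path -/

/-- States of the program that refutes encoded paths. -/
inductive ChkState (M : OracleNPDA σ γ β) : Type
  /-- initial state -/
  | init : ChkState M
  /-- following the encoded path -/
  | copy (q : M.Q) (f : Fmt) : ChkState M
  /-- comparing the answer in the encoded path with that of the oracle -/
  | check (f : Fmt) (b : Bool) : ChkState M
  /-- following a smaller path, with the next tape symbol and the next transition if they are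
  known already -/
  | free (q : M.Q) (f : Fmt) (buf : Option (TapeSymbol σ)) (cm : Option M.Instr) : ChkState M
  /-- accepting state -/
  | acc : ChkState M

instance [Finite σ] (M : OracleNPDA σ γ β) : Finite (ChkState M) := by
  have := M.finite_Q
  refine Finite.of_surjective
    (fun o : Bool ⊕ (M.Q × Fmt) ⊕ (Fmt × Bool) ⊕
        (M.Q × Fmt × Option (TapeSymbol σ) × Option M.Instr) => match o with
      | .inl true => ChkState.init
      | .inl false => .acc
      | .inr (.inl (q, f)) => .copy q f
      | .inr (.inr (.inl (f, b))) => .check f b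
      | .inr (.inr (.inr (q, f, buf, cm))) => .free q f buf cm) ?_
  rintro (_ | ⟨q, f⟩ | ⟨f, b⟩ | ⟨q, f, buf, cm⟩ | _)
  exacts [⟨.inl true, rfl⟩, ⟨.inr (.inl (q, f)), rfl⟩, ⟨.inr (.inr (.inl (f, b))), rfl⟩,
    ⟨.inr (.inr (.inr (q, f, buf, cm))), rfl⟩, ⟨.inl false, rfl⟩]

/-- Transitions of the program that refutes encoded paths. -/
inductive ChkMove (M : OracleNPDA σ γ β) (code : M.Label → ℕ) :
    ChkState M → Option (TapeSymbol M.PathSymbol) → Option M.Θ →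
      ChkState M × List M.Θ × (Option Empty × Option β) → Prop
  | init : ChkMove M code .init (some .leftEnd) none (.copy M.q₀ .start, [M.Z₀], (none, none))
  -- Moves that would make the format bad are blocked. Some words that encode nothing are thereby
  -- not accepted, which is harmless: the guesser queries only words whose tape symbols form a
  -- prefix of its input tape.
  | follow (t : M.Instr) (f : Fmt) (ht : Enabled t) (hf : f.evalFrom t.read.toList ≠ .bad) :
      ChkMove M code (.copy t.src f) (some (.letter (.inl (.inl t)))) (some t.top)
        (.copy t.dst (f.evalFrom t.read.toList), t.push, (none, t.qry))
  -- The letter of `t` is consumed, but its tape symbol must remain available to the new path and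
  -- goes into the buffer. The stack is left unchanged: `t'` is only committed here and is carried
  -- out later by `exec`.
  | diverge (t t' : M.Instr) (f : Fmt) (ht' : Enabled t') (hc : code (.inl t') < code (.inl t))
      (hf : f.evalFrom t.read.toList ≠ .bad) :
      ChkMove M code (.copy t'.src f) (some (.letter (.inl (.inl t)))) (some t'.top)
        (.free t'.src (f.evalFrom t.read.toList) t.read (some t'), [t'.top], (none, none))
  | wrong (t : M.Instr) (q : M.Q) (f : Fmt) (tp : Option M.Θ)
      (h : ¬ (Enabled t ∧ q = t.src ∧ tp = some t.top)) :
      ChkMove M code (.copy q f) (some (.letter (.inl (.inl t)))) tp (.acc, [], (none, none))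
  | ask (f : Fmt) (b : Bool) (tp : Option M.Θ) :
      ChkMove M code (.copy M.qQuery f) (some (.letter (.inl (.inr b)))) tp
        (.check f b, tp.toList, (none, none))
  | wrongAsk (q : M.Q) (f : Fmt) (b : Bool) (tp : Option M.Θ) (hq : q ≠ M.qQuery) :
      ChkMove M code (.copy q f) (some (.letter (.inl (.inr b)))) tp (.acc, [], (none, none))
  | skip (q : M.Q) (f : Fmt) (s : TapeSymbol σ) (tp : Option M.Θ) (hq : q ∈ M.acc)
      (hf : f.evalFrom [s] ≠ .bad) :
      ChkMove M code (.copy q f) (some (.letter (.inr s))) tp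
        (.copy q (f.evalFrom [s]), tp.toList, (none, none))
  | early (q : M.Q) (f : Fmt) (s : TapeSymbol σ) (tp : Option M.Θ) (hq : q ∉ M.acc) :
      ChkMove M code (.copy q f) (some (.letter (.inr s))) tp (.acc, [], (none, none))
  | finish (q : M.Q) (f : Fmt) (tp : Option M.Θ) (h : q ∈ M.acc → f ≠ .fin) :
      ChkMove M code (.copy q f) (some .rightEnd) tp (.acc, [], (none, none))
  | load (k : M.PathSymbol) (q : M.Q) (f : Fmt) (cm : Option M.Instr) (tp : Option M.Θ)
      (hf : f.evalFrom (symRead k).toList ≠ .bad) :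
      ChkMove M code (.free q f none cm) (some (.letter k)) tp
        (.free q (f.evalFrom (symRead k).toList) (symRead k) cm, tp.toList, (none, none))
  | exec (t : M.Instr) (f : Fmt) (buf buf' : Option (TapeSymbol σ)) (cm : Option M.Instr)
      (ht : Enabled t) (hbuf : buf.toList = t.read.toList ++ buf'.toList)
      (hcm : cm = none ∨ cm = some t) :
      ChkMove M code (.free t.src f buf cm) none (some t.top)
        (.free t.dst f buf' none, t.push, (none, t.qry))
  | success (q : M.Q) (f : Fmt) (buf : Option (TapeSymbol σ)) (tp : Option M.Θ)
      (hq : q ∈ M.acc) :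
      ChkMove M code (.free q f buf none) none tp (.acc, [], (none, none))

open Classical in
/-- The queries of the program that refutes encoded paths. -/
noncomputable def chkAsk (M : OracleNPDA σ γ β) : ChkState M → Option (Bool → ChkState M)
  | .check f b => some fun b' => if b = b' then .copy (M.answerState b) f else .acc
  | .free q f buf none =>
      if q = M.qQuery then some fun b => .free (M.answerState b) f buf none else none
  | _ => none

theorem finite_chkMove [Finite σ] (M : OracleNPDA σ γ β) (code : M.Label → ℕ) (q : ChkState M)
    (a : Option (TapeSymbol M.PathSymbol)) (tp : Option M.Θ) :
    {v | ChkMove M code q a tp v}.Finite := by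
  have hU : (({[M.Z₀], [], tp.toList} : Set (List M.Θ)) ∪ Set.range (Instr.push (M := M))).Finite :=
    (Set.toFinite _).union (Set.finite_range _)
  have hW : (({(none, none)} : Set (Option Empty × Option β)) ∪
      Set.range fun t : M.Instr => (none, t.qry)).Finite :=
    (Set.toFinite _).union (Set.finite_range _)
  refine ((Set.finite_univ (α := ChkState M)).prod (hU.prod hW)).subset ?_
  rintro v hv
  cases hv <;> simp

/-- The program that accepts the words that do not encode a least accepting path. -/
noncomputable abbrev checker [Finite σ] (M : OracleNPDA σ γ β) (code : M.Label → ℕ) :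
    Prog M.PathSymbol Empty β where
  Q := ChkState M
  Θ := M.Θ
  finite_Q := inferInstance
  finite_Θ := M.finite_Θ
  δ q a tp := {v | ChkMove M code q a tp v}
  finite_δ := M.finite_chkMove code
  q₀ := .init
  acc := {.acc}
  ask := M.chkAsk

/-- The unread part of the tape of the checker. -/
def chkRest (z : List M.PathSymbol) : List (TapeSymbol M.PathSymbol) :=
  z.map .letter ++ [.rightEnd]

theorem chkAsk_free {q : M.Q} {f : Fmt} {buf : Option (TapeSymbol σ)} {cm : Option M.Instr}
    (hq : q ≠ M.qQuery) : M.chkAsk (.free q f buf cm) = none := by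
  cases cm <;> simp [chkAsk, hq]

/-! ### Completeness of the checker: wrong encodings and encodings of non-least paths are accepted
-/

section Completeness

variable [Finite σ] {code : M.Label → ℕ}

/-- An accepting configuration of the checker can be reached. -/
def ChkAccepts (M : OracleNPDA σ γ β) (code : M.Label → ℕ) (A : Language β) (q : ChkState M)
    (i : List (TapeSymbol M.PathSymbol)) (s : List M.Θ) (y : List β) : Prop :=
  ∀ o, ∃ d : (M.checker code).Cfg, d.state = .acc ∧
    Relation.ReflTransGen ((M.checker code).Step A) ⟨q, i, s, y, o⟩ d

theorem chkAccepts_acc {i : List (TapeSymbol M.PathSymbol)} {s : List M.Θ} {y : List β} :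
    ChkAccepts M code A .acc i s y :=
  fun _ => ⟨_, rfl, .refl⟩

theorem chkAccepts_of_move {q q' : ChkState M} {a : Option (TapeSymbol M.PathSymbol)}
    {i : List (TapeSymbol M.PathSymbol)} {s u : List M.Θ} {y : List β}
    {w : Option Empty × Option β} (hq : q ≠ .acc) (hask : M.chkAsk q = none)
    (hm : ChkMove M code q a s.head? (q', u, w))
    (h : ChkAccepts M code A q' i (u ++ s.tail) (y ++ w.2.toList)) :
    ChkAccepts M code A q (a.toList ++ i) s y := by
  intro o
  obtain ⟨d, hd, hr⟩ := h (o ++ w.1.toList)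
  exact ⟨d, hd, .head (.move hq hask rfl hm) hr⟩

theorem chkAccepts_of_ask {q : ChkState M} {r : Bool → ChkState M}
    {i : List (TapeSymbol M.PathSymbol)} {s : List M.Θ} {y : List β} (b : Bool)
    (hq : q ≠ .acc) (hask : M.chkAsk q = some r) (hb : b = true ↔ y ∈ A)
    (h : ChkAccepts M code A (r b) i s []) : ChkAccepts M code A q i s y := by
  intro o
  obtain ⟨d, hd, hr⟩ := h o
  exact ⟨d, hd, .head (.ask b hq hask hb) hr⟩

theorem head?_toList_append_tail {α : Type} (s : List α) : s.head?.toList ++ s.tail = s := by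
  cases s <;> rfl

/-- The free path and `z` may make their `λ`-moves at different times, so several letters of `z`
without a tape symbol may have to be passed before the next one is found. -/
theorem chkAccepts_of_load {q : M.Q} {cm : Option M.Instr} {s : List M.Θ} {y : List β}
    {s₀ : TapeSymbol σ} {v : List (TapeSymbol σ)} (hq : q ≠ M.qQuery) :
    ∀ {z : List M.PathSymbol} {f : Fmt}, symReads z = s₀ :: v →
      f.evalFrom (symReads z) ≠ .bad →
      (∀ z' f', symReads z' = v → Fmt.evalFrom f' v ≠ .bad →
        ChkAccepts M code A (.free q f' (some s₀) cm) (chkRest z') s y) →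
      ChkAccepts M code A (.free q f none cm) (chkRest z) s y
  | [], f, h, _, _ => by simp at h
  | k :: z, f, h, hf, hk => by
    have hf' := hf
    rw [symReads_cons] at hf' h
    refine chkAccepts_of_move (a := some (.letter k)) (by simp) (chkAsk_free hq)
      (.load k q f cm _ (Fmt.evalFrom_ne_bad_of_append hf')) ?_
    rw [head?_toList_append_tail]
    rw [Fmt.evalFrom_append] at hf'
    simp only [Option.toList_none, List.append_nil]
    cases hr : symRead k with
    | none =>
      rw [hr] at h hf'
      exact chkAccepts_of_load hq h hf' hk
    | some s₁ =>
      rw [hr] at h hf'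
      simp only [Option.toList_some, List.cons_append, List.nil_append, List.cons.injEq] at h
      obtain ⟨rfl, rfl⟩ := h
      exact hk z _ rfl hf'

/-- Induction along the free path. It need not be synchronous with `z`: it only matters that the
buffer and the rest of `z` together begin with the symbols that the path still reads. -/
theorem chkAccepts_free {c d : M.Core} {p : List M.Label} (hp : M.Run A c p d)
    (hd : d.state ∈ M.acc) {z : List M.PathSymbol} {f : Fmt} {buf : Option (TapeSymbol σ)}
    {cm : Option M.Instr} {r : List (TapeSymbol σ)}
    (hcm : ∀ t, cm = some t → p.head? = some (.inl t))
    (hr : buf.toList ++ symReads z = reads p ++ r) (hf : f.evalFrom (symReads z) ≠ .bad) :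
    ChkAccepts M code A (.free c.state f buf cm) (chkRest z) c.stack c.query := by
  induction hp generalizing z f buf cm with
  | nil c =>
    obtain rfl : cm = none := by
      cases cm with
      | none => rfl
      | some t => simpa using hcm t rfl
    have hq : c.state ≠ M.qQuery := fun h => M.query_not_halt (.inl (h ▸ hd))
    exact chkAccepts_of_move (a := none) (by simp) (chkAsk_free hq) (.success _ f buf _ hd)
      chkAccepts_acc
  | @cons c c' d l p hl hp ih =>
    cases hl with
    | instr t s y ht =>
      have hcm' : cm = none ∨ cm = some t := by
        cases cm with
        | none => exact .inl rfl
        | some t' => exact .inr (by have := hcm t' rfl; simp at this; rw [this])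
      have key : ∀ (z : List M.PathSymbol) (f : Fmt) (buf buf' : Option (TapeSymbol σ)),
          buf.toList = t.read.toList ++ buf'.toList →
          buf'.toList ++ symReads z = reads p ++ r → f.evalFrom (symReads z) ≠ .bad →
          ChkAccepts M code A (.free t.src f buf cm) (chkRest z) (t.top :: s) y := by
        intro z f buf buf' h1 h2 h3
        exact chkAccepts_of_move (a := none) (by simp) (chkAsk_free ht.2)
          (.exec t f buf buf' cm ht h1 hcm') (ih hd (by simp) h2 h3)
      rw [reads_cons, labelRead_inl, List.append_assoc] at hr
      cases hread : t.read with
      | none =>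
        rw [hread] at hr
        exact key z f buf buf (by simp [hread]) hr hf
      | some s₀ =>
        rw [hread] at hr
        cases buf with
        | some s₁ =>
          simp only [Option.toList_some, List.cons_append, List.nil_append,
            List.cons.injEq] at hr
          exact key z f (some s₁) none (by simp [hread, hr.1]) hr.2 hf
        | none =>
          refine chkAccepts_of_load ht.2 (s₀ := s₀) (v := reads p ++ r) hr hf ?_
          intro z' f' h1 h2
          exact key z' f' (some s₀) none (by simp [hread]) h1 (h1 ▸ h2)
    | answer b s y hb =>
      obtain rfl : cm = none := by
        cases cm with
        | none => rfl
        | some t => simpa using hcm t rfl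
      exact chkAccepts_of_ask b (by simp)
        (r := fun b => .free (M.answerState b) f buf none) (by simp [chkAsk]) hb
        (ih hd (fun _ h => by cases h) hr hf)

theorem chkAccepts_copy_of_instr {t : M.Instr} {f : Fmt} {s : List M.Θ} {y : List β}
    {z : List M.PathSymbol} (ht : Enabled t) (hf : f.evalFrom t.read.toList ≠ .bad)
    (h : ChkAccepts M code A (.copy t.dst (f.evalFrom t.read.toList)) (chkRest z) (t.push ++ s)
      (y ++ t.qry.toList)) :
    ChkAccepts M code A (.copy t.src f) (chkRest (.inl (.inl t) :: z)) (t.top :: s) y :=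
  chkAccepts_of_move (a := some (.letter (.inl (.inl t)))) (by simp) rfl (.follow t f ht hf) h

/-- A false answer in the word leads to acceptance at once, so the claimed answer may be assumed
correct. -/
theorem chkAccepts_copy_of_answer {b : Bool} {f : Fmt} {s : List M.Θ} {y : List β}
    {z : List M.PathSymbol}
    (h : (b = true ↔ y ∈ A) → ChkAccepts M code A (.copy (M.answerState b) f) (chkRest z) s []) :
    ChkAccepts M code A (.copy M.qQuery f) (chkRest (.inl (.inr b) :: z)) s y := by
  refine chkAccepts_of_move (a := some (.letter (.inl (.inr b)))) (by simp) rfl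
    (.ask f b _) ?_
  rw [head?_toList_append_tail]
  simp only [Option.toList_none, List.append_nil]
  classical
  refine chkAccepts_of_ask (decide (y ∈ A)) (by simp) rfl (by simp) ?_
  split_ifs with hb
  · exact h (by simp [hb])
  · exact chkAccepts_acc

/-- Every defect of an encoding has its own accepting move. If none leads to acceptance, the letters
of `z` are forced one by one to form an accepting run with a complete tape. -/
theorem exists_run_of_not_chkAccepts {z : List M.PathSymbol} {q : M.Q} {f : Fmt} {s : List M.Θ}
    {y : List β} (h : ¬ ChkAccepts M code A (.copy q f) (chkRest z) s y)
    (hf : f.evalFrom (symReads z) ≠ .bad) :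
    f.evalFrom (symReads z) = .fin ∧
      ∃ p r d, z = encode p r ∧ M.Run A ⟨q, s, y⟩ p d ∧ d.state ∈ M.acc := by
  induction z generalizing q f s y with
  | nil =>
    have key : q ∈ M.acc ∧ f = .fin := by
      by_contra hc
      refine h (chkAccepts_of_move (a := some .rightEnd) (i := []) (by simp) rfl
        (.finish q f _ ?_) chkAccepts_acc)
      exact fun h1 h2 => hc ⟨h1, h2⟩
    exact ⟨key.2, [], [], _, rfl, .nil _, key.1⟩
  | cons k z ih =>
    rw [symReads_cons] at hf ⊢
    have hf' := Fmt.evalFrom_ne_bad_of_append hf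
    rw [Fmt.evalFrom_append] at hf ⊢
    rcases k with (t | b) | s₀
    · have key : Enabled t ∧ q = t.src ∧ s.head? = some t.top := by
        by_contra hc
        exact h (chkAccepts_of_move (a := some (.letter (.inl (.inl t)))) (by simp) rfl
          (.wrong t q f _ hc) chkAccepts_acc)
      obtain ⟨ht, rfl, hs⟩ := key
      cases s with
      | nil => simp at hs
      | cons Z s =>
        obtain rfl : Z = t.top := by simpa using hs
        obtain ⟨h1, p, r, d, rfl, h2, h3⟩ :=
          ih (fun h' => h (chkAccepts_copy_of_instr ht hf' h')) hf
        exact ⟨h1, .inl t :: p, r, d, rfl, .cons (.instr t s y ht) h2, h3⟩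
    · have hq : q = M.qQuery := by
        by_contra hc
        exact h (chkAccepts_of_move (a := some (.letter (.inl (.inr b)))) (by simp) rfl
          (.wrongAsk q f b _ hc) chkAccepts_acc)
      subst hq
      have hb : (b = true ↔ y ∈ A) := by
        by_contra hc
        exact h (chkAccepts_copy_of_answer fun hb => absurd hb hc)
      obtain ⟨h1, p, r, d, rfl, h2, h3⟩ :=
        ih (fun h' => h (chkAccepts_copy_of_answer fun _ => h')) hf
      exact ⟨h1, .inr b :: p, r, d, rfl, .cons (.answer b s y hb) h2, h3⟩
    · have hq : q ∈ M.acc := by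
        by_contra hc
        exact h (chkAccepts_of_move (a := some (.letter (.inr s₀))) (by simp) rfl
          (.early q f s₀ _ hc) chkAccepts_acc)
      obtain ⟨h1, p, r, d, rfl, h2, h3⟩ := ih (f := f.evalFrom [s₀]) (q := q) (s := s) (y := y)
        (fun h' => h (chkAccepts_of_move (a := some (.letter (.inr s₀))) (by simp) rfl
          (.skip q f s₀ _ hq hf') (by simpa [head?_toList_append_tail, chkRest] using h'))) hf
      cases h2 with
      | nil => exact ⟨h1, [], s₀ :: r, _, rfl, .nil _, h3⟩
      | cons hl => exact absurd (.inl hq) hl.not_halt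

/-- The checker copies the common part `c₀`, diverges from `l` to `l'`, and then follows the smaller
path to its accepting state. -/
theorem chkAccepts_of_lexBelow {c₀ : List M.Label} {l' l : M.Label} {s' s₁ : List M.Label}
    (hc : code l' < code l) {c d d' : M.Core} {z : List M.PathSymbol} {f : Fmt}
    {r : List (TapeSymbol σ)} (h' : M.Run A c (c₀ ++ l' :: s') d') (hd' : d'.state ∈ M.acc)
    (h : M.Run A c (c₀ ++ l :: s₁) d)
    (hr : symReads (c₀.map .inl ++ .inl l :: z) = reads (c₀ ++ l' :: s') ++ r)
    (hf : f.evalFrom (symReads (c₀.map .inl ++ .inl l :: z)) ≠ .bad) :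
    ChkAccepts M code A (.copy c.state f) (chkRest (c₀.map .inl ++ .inl l :: z))
      c.stack c.query := by
  induction c₀ generalizing c f with
  | nil =>
    simp only [List.map_nil, List.nil_append, symReads_cons] at hr hf h' h ⊢
    have hf' := Fmt.evalFrom_ne_bad_of_append hf
    rw [Fmt.evalFrom_append] at hf
    cases h with
    | cons hl _ =>
    have hrun := h'
    cases h' with
    | cons hl' hs' =>
    -- Only two transitions can differ here: an enabled transition does not start at the query
    -- state, and two answers to the same query coincide.
    rcases l with t | b <;> rcases l' with t' | b'
    · obtain ⟨ht', hsrc, s, hs, -⟩ := hl'.instr_inv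
      obtain ⟨q, st, y⟩ := c
      dsimp only at hsrc hs ⊢
      subst hsrc hs
      refine chkAccepts_of_move (a := some (.letter (.inl (.inl t)))) (by simp) rfl
        (.diverge t t' f ht' hc hf') ?_
      simp only [List.tail_cons, List.cons_append, List.nil_append, Option.toList_none,
        List.append_nil]
      exact chkAccepts_free hrun hd' (by simp) hr hf
    · exact absurd hl'.answer_inv.2.1 (hl.instr_inv.2.1 ▸ hl.instr_inv.1.2)
    · exact absurd hl.answer_inv.2.1 (hl'.instr_inv.2.1 ▸ hl'.instr_inv.1.2)
    · obtain rfl : b = b' := Bool.eq_iff_iff.2 (hl.answer_inv.1.trans hl'.answer_inv.1.symm)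
      exact absurd hc (lt_irrefl _)
  | cons l₀ c₀ ih =>
    simp only [List.map_cons, List.cons_append, symReads_cons, reads_cons, symRead_inl,
      List.append_assoc, List.append_cancel_left_eq] at hr hf h' h ⊢
    have hf' := Fmt.evalFrom_ne_bad_of_append hf
    rw [Fmt.evalFrom_append] at hf
    cases h with
    | cons hl h =>
    cases h' with
    | cons hl' h' =>
    obtain rfl := hl.det hl'
    have := ih (f := f.evalFrom (labelRead l₀).toList) h' h
      (by simpa [List.append_assoc] using hr) (by simpa using hf)
    cases hl with
    | instr t s y ht => exact chkAccepts_copy_of_instr ht hf' this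
    | answer b s y hb => exact chkAccepts_copy_of_answer fun _ => this

end Completeness

end OracleNPDA

/-! ### Soundness and running time of the checker -/

namespace OracleNPDA

variable {σ γ β : Type} {M : OracleNPDA σ γ β} {A : Language β} {code : M.Label → ℕ}

/-- Rules out the error moves: in a correct encoding the next label is always a possible step from
the configuration reached so far. -/
theorem EncodesLeast.lStep {x : List σ} {z : List M.PathSymbol}
    (h : EncodesLeast M A code x z) {p : List M.Label} {r : List (TapeSymbol σ)} {l : M.Label}
    {w : List M.PathSymbol} (hz : z = encode p r ++ .inl l :: w) {c : M.Core}
    (hc : M.Run A M.coreStart p c) : ∃ d, M.LStep A c l d := by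
  obtain ⟨p₀, r₀, rfl, ⟨d, hd, -, -⟩, -⟩ := h
  obtain ⟨p₁, rfl⟩ := encode_split_label hz.symm
  obtain ⟨e, he, hl⟩ := hd.of_append
  obtain rfl := hc.det he
  cases hl with
  | cons hl _ => exact ⟨_, hl⟩

/-- What is known about a configuration that the checker reaches in `n` steps. -/
inductive ChkInv [Finite σ] (M : OracleNPDA σ γ β) (A : Language β) (code : M.Label → ℕ)
    (z : List M.PathSymbol) : ℕ → (M.checker code).Cfg → Prop
  | init : ChkInv M A code z 0 ((M.checker code).start z)
  | copy {n : ℕ} {p : List M.Label} {r : List (TapeSymbol σ)} {z₂ : List M.PathSymbol} {q : M.Q}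
      {f : Fmt} {s : List M.Θ} {y : List β} {o : List Empty}
      (hz : z = encode p r ++ z₂) (hp : M.Run A M.coreStart p ⟨q, s, y⟩)
      (hr : r ≠ [] → q ∈ M.acc) (hf : f = Fmt.start.evalFrom (reads p ++ r)) (hbad : f ≠ .bad)
      -- At most two steps per letter, since an answer is first read and then compared with the
      -- oracle; one step for the left endmarker.
      (hn : n ≤ 2 * (encode p r).length + 1) :
      ChkInv M A code z n ⟨.copy q f, chkRest z₂, s, y, o⟩
  | check {n : ℕ} {p : List M.Label} {b : Bool} {z₂ : List M.PathSymbol}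
      {f : Fmt} {s : List M.Θ} {y : List β} {o : List Empty}
      (hz : z = encode p [] ++ .inl (.inr b) :: z₂)
      (hp : M.Run A M.coreStart p ⟨M.qQuery, s, y⟩)
      (hf : f = Fmt.start.evalFrom (reads p)) (hbad : f ≠ .bad)
      (hn : n ≤ 2 * p.length + 2) :
      ChkInv M A code z n ⟨.check f b, chkRest z₂, s, y, o⟩
  | free {n : ℕ} {z₁ z₂ z₃ : List M.PathSymbol} {p c s' : List M.Label} {l l' : M.Label} {q : M.Q}
      {f : Fmt} {buf : Option (TapeSymbol σ)} {cm : Option M.Instr} {s : List M.Θ} {y : List β}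
      {o : List Empty}
      (hz : z = z₁ ++ z₂) (hz' : z = c.map .inl ++ .inl l :: z₃)
      -- The simulated path, with the committed transition if it is still pending, already lies
      -- below any path that `z` could encode.
      (hp' : p ++ (cm.map Sum.inl).toList = c ++ l' :: s') (hc : code l' < code l)
      (hp : M.Run A M.coreStart p ⟨q, s, y⟩)
      (hf : f = Fmt.start.evalFrom (symReads z₁)) (hbad : f ≠ .bad)
      (hbuf : reads p ++ buf.toList = symReads z₁)
      (hn : n ≤ 2 * z₁.length + p.length + 1) :
      ChkInv M A code z n ⟨.free q f buf cm, chkRest z₂, s, y, o⟩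
  | acc {n : ℕ} {p : List M.Label} {d : M.Core} {C : (M.checker code).Cfg}
      (hC : C.state = .acc) (hp : M.Run A M.coreStart p d)
      (hbad : Fmt.start.evalFrom (reads p) ≠ .bad) (hlen : (reads p).length ≤ z.length)
      (hn : n ≤ 2 * z.length + p.length + 3)
      (hz : ∀ x, symReads z <+: inputTape x → ¬ EncodesLeast M A code x z) :
      ChkInv M A code z n C

theorem chkRest_eq_letter {k : M.PathSymbol} {z : List M.PathSymbol}
    {i : List (TapeSymbol M.PathSymbol)}
    (h : chkRest z = (some (TapeSymbol.letter k)).toList ++ i) :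
    ∃ z', z = k :: z' ∧ i = chkRest z' := by
  cases z with
  | nil => simp [chkRest] at h
  | cons k' z =>
    simp only [chkRest, List.map_cons, List.cons_append, Option.toList_some, List.nil_append,
      List.cons.injEq, TapeSymbol.letter.injEq] at h
    exact ⟨z, by rw [h.1], h.2.symm⟩

theorem chkRest_eq_rightEnd {z : List M.PathSymbol} {i : List (TapeSymbol M.PathSymbol)}
    (h : chkRest z = (some TapeSymbol.rightEnd).toList ++ i) : z = [] := by
  cases z with
  | nil => rfl
  | cons k' z => simp [chkRest] at h

theorem chkAsk_free_eq_some {q : M.Q} {f : Fmt} {buf : Option (TapeSymbol σ)}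
    {cm : Option M.Instr} {r : Bool → ChkState M} (h : M.chkAsk (.free q f buf cm) = some r) :
    q = M.qQuery ∧ cm = none ∧ r = fun b => .free (M.answerState b) f buf none := by
  cases cm with
  | some t => simp [chkAsk] at h
  | none =>
    by_cases hq : q = M.qQuery
    · simp only [chkAsk, hq, if_true, Option.some.injEq] at h
      exact ⟨hq, rfl, h.symm⟩
    · simp [chkAsk, hq] at h

theorem Run.length_le_reads {a b : ℕ}
    (hM : ∀ (A : Language β) (x : List σ), HaltsWithin (M.Step A)
      (fun c => c.cfg.state ∈ M.toPDA.halt) (a * x.length + b) (M.start x))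
    {p : List M.Label} {d : M.Core} (h : M.Run A M.coreStart p d)
    (hf : Fmt.start.evalFrom (reads p) ≠ .bad) : p.length ≤ a * (reads p).length + b := by
  obtain ⟨x, hx, hl⟩ := Fmt.exists_prefix_inputTape hf
  exact (h.length_le hM hx).trans (Nat.add_le_add_right (Nat.mul_le_mul_left _ hl) _)

variable [Finite σ]

theorem ChkInv.acc_of_run_nil {z : List M.PathSymbol} {n : ℕ} {C : (M.checker code).Cfg}
    (hC : C.state = .acc) (hn : n ≤ 2 * z.length + 3)
    (hz : ∀ x, symReads z <+: inputTape x → ¬ EncodesLeast M A code x z) :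
    ChkInv M A code z n C :=
  .acc hC (.nil _) (fun h => by cases h) (Nat.zero_le _) (by simpa using hn) hz

theorem ChkInv.step {z : List M.PathSymbol} {n : ℕ} {C D : (M.checker code).Cfg}
    (hC : ChkInv M A code z n C) (hs : (M.checker code).Step A C D) :
    ChkInv M A code z (n + 1) D := by
  cases hC with
  | init =>
    generalize hE : (M.checker code).start z = E at hs
    cases hs with
    | @move q i i' s y o a q' u w hacc hask hi hδ =>
      simp only [Prog.start, Prog.Cfg.mk.injEq] at hE
      obtain ⟨rfl, rfl, rfl, rfl, rfl⟩ := hE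
      change ChkMove M code .init a none (q', u, w) at hδ
      cases hδ with
      | init =>
        obtain rfl : i' = chkRest z := by simpa [inputTape, chkRest] using hi.symm
        exact .copy (p := []) (r := []) rfl (.nil _) (by simp) rfl (fun h => by cases h)
          (by simp)
    | ask b hacc hask hb =>
      simp only [Prog.start, Prog.Cfg.mk.injEq] at hE
      obtain ⟨rfl, rfl, rfl, rfl, rfl⟩ := hE
      simp [chkAsk] at hask
  | @copy n p r z₂ q f s y o hz hp hr hf hbad hn =>
    cases hs with
    | ask b hacc hask hb => simp [chkAsk] at hask
    | @move _ _ i' _ _ _ a q' u w hacc hask hi hδ =>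
      change ChkMove M code (.copy q f) a s.head? (q', u, w) at hδ
      have hlen := congrArg List.length hz
      rw [List.length_append] at hlen
      generalize htp : s.head? = tp at hδ
      cases hδ with
      | follow t f ht hf' =>
        obtain ⟨z', rfl, rfl⟩ := chkRest_eq_letter hi
        -- Once an unread symbol has been skipped the state is accepting, hence halting, and no
        -- transition is enabled.
        have hr' : r = [] := by
          by_contra hc
          exact ht.1 (.inl (hr hc))
        subst hr'
        cases s with
        | nil => simp at htp
        | cons Z s =>
          obtain rfl : Z = t.top := by simpa using htp
          refine .copy (p := p ++ [.inl t]) (r := []) (by simp [hz, encode])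
            (hp.snoc (.instr t s y ht)) (by simp) ?_ hf' (by simp [encode] at hn ⊢; omega)
          rw [hf]
          simp [Fmt.evalFrom_append]
      | diverge t t' f ht' hc hf' =>
        obtain ⟨z', rfl, rfl⟩ := chkRest_eq_letter hi
        have hr' : r = [] := by
          by_contra hc
          exact ht'.1 (.inl (hr hc))
        subst hr'
        cases s with
        | nil => simp at htp
        | cons Z s =>
          obtain rfl : Z = t'.top := by simpa using htp
          simp only [Option.toList_none, List.append_nil]
          refine .free (z₁ := p.map .inl ++ [.inl (.inl t)]) (c := p) (l := .inl t)
            (l' := .inl t') (s' := []) (p := p) (by simp [hz, encode]) (by simp [hz, encode]; rfl)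
            (by simp) hc hp ?_ hf' (by simp) (by simp [encode] at hn ⊢; omega)
          rw [hf]
          simp [Fmt.evalFrom_append]
      | wrong t q f tp h =>
        obtain ⟨z', rfl, rfl⟩ := chkRest_eq_letter hi
        refine .acc_of_run_nil rfl (by omega) fun x hx hg => h ?_
        obtain ⟨d, hd⟩ := hg.lStep hz hp
        obtain ⟨h1, h2, s', h3, -⟩ := hd.instr_inv
        refine ⟨h1, h2, ?_⟩
        rw [← htp, show s = t.top :: s' from h3]
        rfl
      | ask f b tp =>
        obtain ⟨z', rfl, rfl⟩ := chkRest_eq_letter hi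
        have hr' : r = [] := by
          by_contra hc
          exact M.query_not_halt (.inl (hr hc))
        subst hr' htp
        rw [head?_toList_append_tail]
        simp only [Option.toList_none, List.append_nil]
        exact .check hz hp (by simpa using hf) hbad (by simp [encode] at hn ⊢; omega)
      | wrongAsk q f b tp hq =>
        obtain ⟨z', rfl, rfl⟩ := chkRest_eq_letter hi
        refine .acc_of_run_nil rfl (by omega) fun x hx hg => hq ?_
        obtain ⟨d, hd⟩ := hg.lStep hz hp
        exact hd.answer_inv.2.1
      | skip q f s₀ tp hq hf' =>
        obtain ⟨z', rfl, rfl⟩ := chkRest_eq_letter hi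
        subst htp
        rw [head?_toList_append_tail]
        simp only [Option.toList_none, List.append_nil]
        refine .copy (p := p) (r := r ++ [s₀]) (by simp [hz, encode]) hp (fun _ => hq) ?_ hf'
          (by simp [encode] at hn ⊢; omega)
        rw [hf, ← Fmt.evalFrom_append, List.append_assoc]
      | early q f s₀ tp hq =>
        obtain ⟨z', rfl, rfl⟩ := chkRest_eq_letter hi
        refine .acc_of_run_nil rfl (by omega) fun x hx hg => hq ?_
        obtain ⟨p₀, r₀, hz₀, ⟨d, hd, hacc, -⟩, -⟩ := hg
        have hr' : r = [] := by
          by_contra hc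
          exact hq (hr hc)
        subst hr'
        rw [hz] at hz₀
        obtain ⟨p₁, rfl, h1⟩ := encode_split (p := p) (w := .inr s₀ :: z')
          (by simpa [encode] using hz₀)
        cases p₁ with
        | cons => simp [encode] at h1
        | nil =>
          rw [List.append_nil] at hd
          obtain rfl := hp.det hd
          exact hacc
      | finish q f tp h =>
        obtain rfl := chkRest_eq_rightEnd hi
        refine .acc_of_run_nil rfl (by omega) fun x hx hg => ?_
        obtain ⟨p₀, r₀, hz₀, ⟨d, hd, hacc, hx'⟩, -⟩ := hg
        rw [hz, List.append_nil] at hz₀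
        obtain ⟨rfl, rfl⟩ := encode_inj hz₀
        obtain rfl := hp.det hd
        refine h hacc ?_
        rw [hf, hx', Fmt.start_evalFrom_inputTape]
  | @check n p b z₂ f s y o hz hp hf hbad hn =>
    have hlen := congrArg List.length hz
    cases hs with
    | @move q i i' s y o a q' u w hacc hask hi hδ => simp [chkAsk] at hask
    | @ask _ _ _ _ _ r b' hacc hask hb =>
      simp only [chkAsk, Option.some.injEq] at hask
      subst hask
      dsimp only
      split_ifs with h
      · subst h
        exact .copy (p := p ++ [.inr b]) (r := []) (by simp [hz, encode])
          (hp.snoc (.answer b s y hb)) (by simp) (by simp [hf]) hbad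
          (by simp [encode] at hn ⊢; omega)
      · refine .acc_of_run_nil rfl (by simp [encode] at hlen; omega) fun x hx hg => h ?_
        obtain ⟨d, hd⟩ := hg.lStep hz hp
        exact Bool.eq_iff_iff.2 (hd.answer_inv.1.trans hb.symm)
  | @free n z₁ z₂ z₃ p c s' l l' q f buf cm s y o hz hz' hp' hc hp hf hbad hbuf hn =>
    have hlen := congrArg List.length hz
    rw [List.length_append] at hlen
    cases hs with
    | @ask _ _ _ _ _ r b hacc hask hb =>
      obtain ⟨rfl, rfl, rfl⟩ := chkAsk_free_eq_some hask
      refine .free (p := p ++ [.inr b]) (c := c) (s' := s' ++ [.inr b]) hz hz' ?_ hc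
        (hp.snoc (.answer b s y hb)) hf hbad (by simpa using hbuf) (by simp; omega)
      simpa using congrArg (· ++ [.inr b]) hp'
    | @move _ _ i' _ _ _ a q' u w hacc hask hi hδ =>
      change ChkMove M code (.free q f buf cm) a s.head? (q', u, w) at hδ
      generalize htp : s.head? = tp at hδ
      cases hδ with
      | load k q f cm tp hf' =>
        obtain ⟨z', rfl, rfl⟩ := chkRest_eq_letter hi
        subst htp
        rw [head?_toList_append_tail]
        simp only [Option.toList_none, List.append_nil]
        refine .free (z₁ := z₁ ++ [k]) (by simp [hz]) hz' hp' hc hp ?_ hf' ?_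
          (by simp; omega)
        · simp [hf, Fmt.evalFrom_append]
        · simpa using hbuf
      | exec t f buf buf' cm ht hb hcm =>
        obtain rfl : i' = chkRest z₂ := hi.symm
        cases s with
        | nil => simp at htp
        | cons Z s =>
          obtain rfl : Z = t.top := by simpa using htp
          have hex : ∃ s'', p ++ [.inl t] = c ++ l' :: s'' := by
            rcases hcm with rfl | rfl
            · exact ⟨s' ++ [.inl t], by simpa using congrArg (· ++ [.inl t]) hp'⟩
            · exact ⟨s', hp'⟩
          obtain ⟨s'', hs''⟩ := hex
          refine .free (p := p ++ [.inl t]) (c := c) hz hz' (by simpa using hs'') hc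
            (hp.snoc (.instr t s y ht)) hf hbad ?_ (by simp; omega)
          rw [← hbuf, hb]
          simp
      | success q f buf tp hq =>
        obtain rfl : i' = chkRest z₂ := hi.symm
        have hle : (reads p).length ≤ z.length := by
          have h1 := congrArg List.length hbuf
          have h2 := length_symReads_le z₁
          rw [List.length_append] at h1
          omega
        refine .acc rfl hp ?_ hle (by omega) fun x hx hg => ?_
        · rw [hf, ← hbuf] at hbad
          exact Fmt.evalFrom_ne_bad_of_append hbad
        · obtain ⟨p₀, r₀, hz₀, -, hleast⟩ := hg
          have hz₀' := hz'.symm.trans hz₀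
          obtain ⟨p₁, rfl⟩ := encode_split_label (p := c) (r := []) (l := l) (w := z₃)
            (by simpa [encode] using hz₀')
          obtain ⟨v, hv⟩ := hx
          rw [hz, symReads_append, ← hbuf, List.append_assoc, List.append_assoc] at hv
          -- The simulated path leaves unread the buffer, the symbols in `z₂` and the remainder `v`
          -- of the tape. Being accepting and smaller, it contradicts leastness.
          exact hleast p _ ⟨_, hp, hq, hv⟩ ⟨c, l', l, s', p₁, by simpa using hp', rfl, hc⟩
  | acc hC =>
    exfalso
    cases hs with
    | move hacc => exact hacc hC
    | ask _ hacc => exact hacc hC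

theorem ChkInv.of_steps {z : List M.PathSymbol} {n : ℕ} {C : (M.checker code).Cfg}
    (h : Steps ((M.checker code).Step A) n ((M.checker code).start z) C) :
    ChkInv M A code z n C := by
  generalize hs : (M.checker code).start z = S at h
  induction h with
  | refl => subst hs; exact .init
  | tail _ h ih => exact (ih hs).step h

theorem ChkInv.exists_run {z : List M.PathSymbol} {n : ℕ} {C : (M.checker code).Cfg}
    (h : ChkInv M A code z n C) :
    ∃ p d, M.Run A M.coreStart p d ∧ Fmt.start.evalFrom (reads p) ≠ .bad ∧
      (reads p).length ≤ z.length ∧ n ≤ 2 * z.length + p.length + 3 := by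
  have hnil : n ≤ 2 * z.length + 3 → ∃ p d, M.Run A M.coreStart p d ∧
      Fmt.start.evalFrom (reads p) ≠ .bad ∧
      (reads p).length ≤ z.length ∧ n ≤ 2 * z.length + p.length + 3 := fun hn =>
    ⟨[], _, .nil _, (fun h => by cases h), Nat.zero_le _, by simpa using hn⟩
  cases h with
  | init => exact hnil (by omega)
  | copy hz hp hr hf hbad hn =>
    have hlen := congrArg List.length hz
    rw [List.length_append] at hlen
    exact hnil (by omega)
  | check hz hp hf hbad hn =>
    have hlen := congrArg List.length hz
    simp only [encode, List.length_append, List.length_map] at hlen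
    exact hnil (by omega)
  | @free n z₁ z₂ z₃ p c s' l l' q f buf cm s y o hz hz' hp' hc hp hf hbad hbuf hn =>
    have hlen := congrArg List.length hz
    rw [List.length_append] at hlen
    have h1 := congrArg List.length hbuf
    have h2 := length_symReads_le z₁
    rw [List.length_append] at h1
    rw [hf, ← hbuf] at hbad
    exact ⟨p, _, hp, Fmt.evalFrom_ne_bad_of_append hbad, by omega, by omega⟩
  | acc hC hp hbad hlen hn hz => exact ⟨_, _, hp, hbad, hlen, hn⟩

/-- Apart from two steps per letter, only the simulated run costs time. Its symbols come from the
word and have a good format, so `M` bounds its length by `a * z.length + b`, whatever the oracle. -/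
theorem checker_bounded (hM : M.LinearTime) (code : M.Label → ℕ) : (M.checker code).Bounded := by
  obtain ⟨a, b, hab⟩ := hM
  refine ⟨a + 2, b + 3, fun A z n C h => ?_⟩
  obtain ⟨p, d, hp, hbad, hl, hn⟩ := (ChkInv.of_steps h).exists_run
  have := hp.length_le_reads hab hbad
  nlinarith [Nat.mul_le_mul_left a hl]

theorem checker_outputs_nonempty_iff {x : List σ} {z : List M.PathSymbol}
    (hz : symReads z <+: inputTape x) :
    ((M.checker code).outputs A z).Nonempty ↔ ¬ EncodesLeast M A code x z := by
  constructor
  · rintro ⟨_, C, hC, -, h⟩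
    obtain ⟨n, h⟩ := Steps.exists_of_reflTransGen h
    cases ChkInv.of_steps h with
    | acc hC' hp hbad hlen hn h' => exact h' x hz
    | _ => cases hC
  · intro hg
    by_contra hne
    have hbad := Fmt.evalFrom_ne_bad_of_isPrefix hz
    have hnot : ¬ ChkAccepts M code A (.copy M.q₀ .start) (chkRest z) [M.Z₀] [] := by
      intro h
      have : ChkAccepts M code A .init (inputTape z) [] [] :=
        chkAccepts_of_move (a := some .leftEnd) (i := chkRest z) (by simp) rfl .init h
      obtain ⟨d, hd, hr⟩ := this []
      exact hne ⟨_, d, hd, rfl, hr⟩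
    obtain ⟨hfin, p, r, d, rfl, hp, hd⟩ := exists_run_of_not_chkAccepts hnot hbad
    -- A prefix of the tape that contains the right endmarker is the entire tape.
    have hx := Fmt.eq_inputTape_of_evalFrom_eq_fin hz hfin
    rw [symReads_encode] at hx
    refine hg ⟨p, r, rfl, ⟨d, hp, hd, hx⟩, ?_⟩
    rintro p' r' ⟨d', hp', hd', hx'⟩ ⟨c, l', l, s', s, rfl, rfl, hc⟩
    have henc : encode (c ++ l :: s) r = c.map .inl ++ .inl l :: encode s r := by simp [encode]
    refine hnot ?_
    rw [henc]
    refine chkAccepts_of_lexBelow (c := M.coreStart) (r := r') hc hp' hd' hp ?_ ?_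
    · rw [← henc, symReads_encode, hx, hx']
    · rwa [← henc]

end OracleNPDA

namespace OracleNPDA

variable {σ γ β : Type}

/-! ### Guessing encoded paths -/

/-- States of the program that guesses an encoded path. -/
inductive GuessState : Type
  | init
  | run
  | ask
  | answer (b : Bool)

instance : Finite GuessState :=
  Finite.of_surjective
    (fun o : Bool ⊕ Option Bool => match o with
      | .inl b => GuessState.answer b
      | .inr none => .init
      | .inr (some true) => .run
      | .inr (some false) => .ask)
    (by rintro (_ | _ | _ | b)
        exacts [⟨.inr none, rfl⟩, ⟨.inr (some true), rfl⟩, ⟨.inr (some false), rfl⟩,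
          ⟨.inl b, rfl⟩])

/-- Transitions of the program that guesses an encoded path. The stack is a clock that allows
`a` further steps for each tape symbol read, and `b` steps at the beginning. -/
inductive GuessMove (M : OracleNPDA σ γ β) (a b : ℕ) :
    GuessState → Option (TapeSymbol σ) → Option Unit →
      GuessState × List Unit × (Option γ × Option M.PathSymbol) → Prop
  | init : GuessMove M a b .init none none (.run, List.replicate b (), (none, none))
  | write (k : M.PathSymbol) :
      GuessMove M a b .run (symRead k) (some ())
        (.run, List.replicate (a * (symRead k).toList.length) (), (symOut k, some k))
  | ask (tp : Option Unit) : GuessMove M a b .run none tp (.ask, tp.toList, (none, none))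

theorem finite_guessMove [Finite σ] (M : OracleNPDA σ γ β) (a b : ℕ) (q : GuessState)
    (i : Option (TapeSymbol σ)) (tp : Option Unit) : {v | GuessMove M a b q i tp v}.Finite := by
  refine (((Set.finite_range fun k : M.PathSymbol =>
    ((.run, List.replicate (a * (symRead k).toList.length) (), (symOut k, some k)) :
      GuessState × List Unit × (Option γ × Option M.PathSymbol))).insert
    (.run, List.replicate b (), (none, none))).insert (.ask, tp.toList, (none, none))).subset ?_
  intro v hv
  cases hv with
  | init => exact .inr (.inl rfl)
  | write k => exact .inr (.inr ⟨k, rfl⟩)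
  | ask => exact .inl rfl

/-- The program that guesses an encoded path on its input, writes the output of that path, and
asks the oracle whether the path is the right one. -/
abbrev guesser [Finite σ] (M : OracleNPDA σ γ β) (a b : ℕ) : Prog σ γ M.PathSymbol where
  Q := GuessState
  Θ := Unit
  finite_Q := inferInstance
  finite_Θ := inferInstance
  δ q i tp := {v | GuessMove M a b q i tp v}
  finite_δ := M.finite_guessMove a b
  q₀ := .init
  acc := {.answer true}
  ask
    | .ask => some .answer
    | _ => none

variable {M : OracleNPDA σ γ β} {A : Language β}

theorem symOuts_append (z z' : List M.PathSymbol) :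
    symOuts (z ++ z') = symOuts z ++ symOuts z' := List.flatMap_append

/-! ### Correctness and running time of the guesser -/

section Guesser

variable [Finite σ] {a b : ℕ}

/-- What is known about a configuration that the guesser reaches in `n` steps. -/
inductive GuessInv (M : OracleNPDA σ γ β) (a b : ℕ) (O : Language M.PathSymbol) (x : List σ) :
    ℕ → (M.guesser a b).Cfg → Prop
  | init : GuessInv M a b O x 0 ((M.guesser a b).start x)
  | run {z : List M.PathSymbol} {i : List (TapeSymbol σ)} {m : ℕ}
      (hi : symReads z ++ i = inputTape x) (hm : m + z.length = b + a * (symReads z).length) :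
      GuessInv M a b O x (z.length + 1) ⟨.run, i, List.replicate m (), z, symOuts z⟩
  | ask {z : List M.PathSymbol} {i : List (TapeSymbol σ)} {s : List Unit}
      (hi : symReads z ++ i = inputTape x) (hm : z.length ≤ b + a * (symReads z).length) :
      GuessInv M a b O x (z.length + 2) ⟨.ask, i, s, z, symOuts z⟩
  | answer {z : List M.PathSymbol} {i : List (TapeSymbol σ)} {s : List Unit} {c : Bool}
      (hi : symReads z ++ i = inputTape x) (hm : z.length ≤ b + a * (symReads z).length)
      (hc : c = true ↔ z ∈ O) :
      GuessInv M a b O x (z.length + 3) ⟨.answer c, i, s, [], symOuts z⟩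

theorem GuessInv.step {O : Language M.PathSymbol} {x : List σ} {n : ℕ}
    {C D : (M.guesser a b).Cfg} (hC : GuessInv M a b O x n C)
    (hs : (M.guesser a b).Step O C D) : GuessInv M a b O x (n + 1) D := by
  cases hC with
  | init =>
    generalize hE : (M.guesser a b).start x = E at hs
    cases hs with
    | @move q i i' s y o c q' u w hacc hask hi hδ =>
      simp only [Prog.start, Prog.Cfg.mk.injEq] at hE
      obtain ⟨rfl, rfl, rfl, rfl, rfl⟩ := hE
      change GuessMove M a b .init c none (q', u, w) at hδ
      cases hδ with
      | init =>
        have := GuessInv.run (M := M) (a := a) (b := b) (O := O) (x := x) (z := []) (i := i')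
          (m := b) hi.symm (by simp)
        simpa using this
    | ask c hacc hask hb =>
      simp only [Prog.start, Prog.Cfg.mk.injEq] at hE
      obtain ⟨rfl, rfl, rfl, rfl, rfl⟩ := hE
      simp at hask
  | @run z i m hi hm =>
    cases hs with
    | ask c hacc hask hb => simp at hask
    | @move _ _ i' _ _ _ c q' u w hacc hask hi' hδ =>
      change GuessMove M a b .run c (List.replicate m ()).head? (q', u, w) at hδ
      generalize htp : (List.replicate m ()).head? = tp at hδ
      cases hδ with
      | write k =>
        cases m with
        | zero => simp at htp
        | succ m =>
          have := GuessInv.run (M := M) (a := a) (b := b) (O := O) (x := x) (z := z ++ [k])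
            (i := i') (m := a * (symRead k).toList.length + m)
            (by rw [← hi, hi']; simp) (by simp [mul_add]; omega)
          simpa [symOuts_append, List.replicate_append_replicate] using this
      | ask tp =>
        have := GuessInv.ask (M := M) (a := a) (b := b) (O := O) (x := x) (z := z) (i := i')
          (s := tp.toList ++ (List.replicate m ()).tail)
          (by rw [← hi, hi']; simp) (by omega)
        simpa using this
  | ask hi hm =>
    cases hs with
    | move hacc hask => simp at hask
    | ask c hacc hask hb =>
      obtain rfl := Option.some.inj hask
      exact .answer hi hm hb
  | @answer z i s c hi hm hc =>
    exfalso
    cases hs with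
    | move hacc hask hi' hδ =>
      generalize List.head? s = tp at hδ
      cases hδ
    | ask c hacc hask hb => simp at hask

theorem GuessInv.of_steps {O : Language M.PathSymbol} {x : List σ} {n : ℕ}
    {C : (M.guesser a b).Cfg}
    (h : Steps ((M.guesser a b).Step O) n ((M.guesser a b).start x) C) :
    GuessInv M a b O x n C := by
  generalize hs : (M.guesser a b).start x = S at h
  induction h with
  | refl => subst hs; exact .init
  | tail _ h ih => exact (ih hs).step h

theorem guesser_bounded (M : OracleNPDA σ γ β) (a b : ℕ) : (M.guesser a b).Bounded := by
  -- The term `2 * a` pays for the two endmarkers; the 3 counts the initial step, the move to the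
  -- asking state and the query.
  refine ⟨a, 2 * a + b + 3, fun O x n C h => ?_⟩
  have key : ∀ {z : List M.PathSymbol} {i : List (TapeSymbol σ)},
      symReads z ++ i = inputTape x → z.length ≤ b + a * (symReads z).length →
      z.length ≤ a * x.length + (2 * a + b) := by
    intro z i hi hm
    have h1 := congrArg List.length hi
    simp only [List.length_append, inputTape, List.length_cons, List.length_map,
      List.length_nil] at h1
    have h2 : (symReads z).length ≤ x.length + 2 := by omega
    nlinarith [Nat.mul_le_mul_left a h2]
  cases GuessInv.of_steps h with
  | init => omega
  | run hi hm => have := key hi (by omega); omega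
  | ask hi hm => have := key hi hm; omega
  | answer hi hm => have := key hi hm; omega

/-- Each symbol written removes one unit from the clock. The budget must therefore be positive
before every symbol, which is a condition on all proper prefixes of `z`. -/
theorem reflTransGen_guesser {O : Language M.PathSymbol} {z : List M.PathSymbol}
    {i : List (TapeSymbol σ)} {m : ℕ} {y : List M.PathSymbol} {o : List γ}
    (hz : ∀ z₁ k z₂, z = z₁ ++ k :: z₂ → z₁.length < m + a * (symReads z₁).length) :
    ∃ m', Relation.ReflTransGen ((M.guesser a b).Step O)
      ⟨.run, symReads z ++ i, List.replicate m (), y, o⟩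
      ⟨.run, i, List.replicate m' (), y ++ z, o ++ symOuts z⟩ := by
  induction z generalizing m y o with
  | nil => exact ⟨m, by simpa using .refl⟩
  | cons k z ih =>
    have hm := hz [] k z rfl
    obtain ⟨m, rfl⟩ : ∃ m', m = m' + 1 := ⟨m - 1, by simp at hm; omega⟩
    obtain ⟨m', h⟩ := ih (m := a * (symRead k).toList.length + m) (y := y ++ [k])
      (o := o ++ (symOut k).toList) (by
        rintro z₁ k' z₂ rfl
        have := hz (k :: z₁) k' z₂ rfl
        simp only [List.length_cons, symReads_cons, List.length_append, mul_add] at this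
        omega)
    refine ⟨m', .head (b := ⟨.run, symReads z ++ i,
      List.replicate (a * (symRead k).toList.length + m) (), y ++ [k],
      o ++ (symOut k).toList⟩) ?_ (by simpa using h)⟩
    have := Prog.Step.move (P := M.guesser a b) (A := O) (q := .run)
      (i := symReads (k :: z) ++ i) (i' := symReads z ++ i) (s := List.replicate (m + 1) ())
      (y := y) (z := o) (by simp) rfl (by simp)
      (show _ ∈ {v | GuessMove M a b .run _ _ v} from GuessMove.write k)
    simpa [List.replicate_append_replicate] using this

theorem mem_guesser_outputs_iff {O : Language M.PathSymbol} {x : List σ} {o : List γ}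
    (hO : ∀ z, z ∈ O → symReads z <+: inputTape x → ∀ z₁ k z₂, z = z₁ ++ k :: z₂ →
      z₁.length < b + a * (symReads z₁).length) :
    o ∈ (M.guesser a b).outputs O x ↔
      ∃ z ∈ O, symReads z <+: inputTape x ∧ symOuts z = o := by
  constructor
  · rintro ⟨C, hC, rfl, h⟩
    obtain ⟨n, h⟩ := Steps.exists_of_reflTransGen h
    cases GuessInv.of_steps h with
    | @answer z i s c hi hm hc =>
      obtain rfl : c = true := by simpa using hC
      exact ⟨z, hc.1 rfl, ⟨i, hi⟩, rfl⟩
    | _ => cases hC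
  · rintro ⟨z, hz, ⟨i, hi⟩, rfl⟩
    obtain ⟨m, h⟩ := reflTransGen_guesser (b := b) (O := O) (i := i) (y := []) (o := [])
      (hO z hz ⟨i, hi⟩)
    rw [hi] at h
    refine ⟨⟨.answer true, i, List.replicate m (), [], symOuts z⟩, rfl, rfl, ?_⟩
    have h1 : (M.guesser a b).Step O ((M.guesser a b).start x)
        ⟨.run, inputTape x, List.replicate b (), [], []⟩ := by
      have := Prog.Step.move (P := M.guesser a b) (A := O) (q := .init) (i := inputTape x)
        (i' := inputTape x) (s := []) (y := []) (z := []) (by simp) rfl rfl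
        (show _ ∈ {v | GuessMove M a b .init _ _ v} from GuessMove.init)
      simpa [Prog.start] using this
    have h2 : (M.guesser a b).Step O ⟨.run, i, List.replicate m (), z, symOuts z⟩
        ⟨.ask, i, List.replicate m (), z, symOuts z⟩ := by
      have := Prog.Step.move (P := M.guesser a b) (A := O) (q := .run) (i := i)
        (i' := i) (s := List.replicate m ()) (y := z) (z := symOuts z) (by simp) rfl rfl
        (show _ ∈ {v | GuessMove M a b .run _ _ v} from GuessMove.ask _)
      rw [head?_toList_append_tail] at this
      simpa using this
    have h3 : (M.guesser a b).Step O ⟨.ask, i, List.replicate m (), z, symOuts z⟩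
        ⟨.answer true, i, List.replicate m (), [], symOuts z⟩ :=
      .ask true (by simp) rfl (by simpa using hz)
    exact .head h1 ((Relation.ReflTransGen.tail h h2).tail h3)

end Guesser

/-! ### The least accepting path -/

theorem LexBelow.map_lt {code : M.Label → ℕ} {p' p : List M.Label} (h : LexBelow code p' p) :
    p'.map code < p.map code := by
  obtain ⟨c, l', l, s', s, rfl, rfl, hc⟩ := h
  induction c with
  | nil => exact List.Lex.rel hc
  | cons l₀ c ih => exact List.Lex.cons ih

theorem isPrefix_or_lexBelow {code : M.Label → ℕ} (hcode : Function.Injective code) :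
    ∀ p p' : List M.Label, p <+: p' ∨ p' <+: p ∨ LexBelow code p p' ∨ LexBelow code p' p
  | [], p' => .inl ⟨p', rfl⟩
  | p, [] => .inr (.inl ⟨p, rfl⟩)
  | l :: p, l' :: p' => by
    rcases lt_trichotomy (code l) (code l') with h | h | h
    · exact .inr (.inr (.inl ⟨[], l, l', p, p', rfl, rfl, h⟩))
    · obtain rfl := hcode h
      have hcons : ∀ {s s' : List M.Label}, LexBelow code s s' →
          LexBelow code (l :: s) (l :: s') := by
        rintro _ _ ⟨c, l₁, l₂, s₁, s₂, rfl, rfl, hc⟩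
        exact ⟨l :: c, l₁, l₂, s₁, s₂, rfl, rfl, hc⟩
      rcases isPrefix_or_lexBelow hcode p p' with h | h | h | h
      · exact .inl (List.cons_prefix_cons.2 ⟨rfl, h⟩)
      · exact .inr (.inl (List.cons_prefix_cons.2 ⟨rfl, h⟩))
      · exact .inr (.inr (.inl (hcons h)))
      · exact .inr (.inr (.inr (hcons h)))
    · exact .inr (.inr (.inr ⟨[], l', l, p', p, rfl, rfl, h⟩))

/-- Two accepting paths on `x` are equal or comparable by `LexBelow`, as neither can be a proper
prefix of the other. The unread part is then determined by the tape. -/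
theorem EncodesLeast.unique {code : M.Label → ℕ} (hcode : Function.Injective code) {x : List σ}
    {z z' : List M.PathSymbol} (h : EncodesLeast M A code x z)
    (h' : EncodesLeast M A code x z') : z = z' := by
  obtain ⟨p, r, rfl, hp, hl⟩ := h
  obtain ⟨p', r', rfl, hp', hl'⟩ := h'
  have hpp : p = p' := by
    rcases isPrefix_or_lexBelow hcode p p' with h | h | h | h
    · exact eq_of_accPath_of_isPrefix hp hp' h
    · exact (eq_of_accPath_of_isPrefix hp' hp h).symm
    · exact absurd h (hl' _ _ hp)
    · exact absurd h (hl _ _ hp')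
  subst hpp
  obtain ⟨_, _, _, h1⟩ := hp
  obtain ⟨_, _, _, h2⟩ := hp'
  rw [List.append_cancel_left (h1.trans h2.symm)]

/-- Linear time leaves only finitely many accepting paths over the finite set of labels, so the
lexicographic order of their code words attains a minimum. -/
theorem exists_encodesLeast [Finite σ] {a b : ℕ}
    (hM : ∀ (A : Language β) (x : List σ), HaltsWithin (M.Step A)
      (fun c => c.cfg.state ∈ M.toPDA.halt) (a * x.length + b) (M.start x))
    (code : M.Label → ℕ) {x : List σ} {p : List M.Label} {r : List (TapeSymbol σ)}
    (h : M.AccPath A x p r) : ∃ z, EncodesLeast M A code x z := by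
  have hfin : {p | ∃ r, M.AccPath A x p r}.Finite := by
    refine (List.finite_length_le M.Label (a * x.length + b)).subset ?_
    rintro p ⟨r, d, hp, -, hx⟩
    exact hp.length_le hM ⟨r, hx⟩
  obtain ⟨p₀, ⟨r₀, h₀⟩, hmin⟩ := Set.exists_min_image _ (fun p : List M.Label => p.map code) hfin
    ⟨p, r, h⟩
  exact ⟨encode p₀ r₀, p₀, r₀, rfl, h₀, fun p' r' h' hlt =>
    (hmin p' ⟨r', h'⟩).not_gt hlt.map_lt⟩

/-- The clock never runs out on the word sought. A prefix of an encoding consists of a run, bounded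
by the time bound of `M`, and of unread symbols; the latter raise the factor to `a + 1`, and
strictness raises the constant to `b + 1`. -/
theorem EncodesLeast.length_lt {a b : ℕ}
    (hM : ∀ (A : Language β) (x : List σ), HaltsWithin (M.Step A)
      (fun c => c.cfg.state ∈ M.toPDA.halt) (a * x.length + b) (M.start x))
    {code : M.Label → ℕ} {x : List σ} {z z₁ z₂ : List M.PathSymbol}
    (h : EncodesLeast M A code x z) (hz : z = z₁ ++ z₂) :
    z₁.length < (b + 1) + (a + 1) * (symReads z₁).length := by
  obtain ⟨p, r, rfl, ⟨d, hp, -, hx⟩, -⟩ := h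
  have key : ∀ {p₁ p₂ : List M.Label}, p = p₁ ++ p₂ →
      p₁.length ≤ a * (reads p₁).length + b := by
    rintro p₁ p₂ rfl
    obtain ⟨d₁, h₁, -⟩ := hp.of_append
    refine h₁.length_le_reads hM (Fmt.evalFrom_ne_bad_of_isPrefix (x := x) ?_)
    rw [← hx]
    simp [List.append_assoc]
  rcases List.append_eq_append_iff.1 hz with ⟨w, rfl, hw⟩ | ⟨w, hw, -⟩
  · obtain ⟨r₁, r₂, -, rfl, rfl⟩ := List.map_eq_append_iff.1 hw
    have := key (p₁ := p) (p₂ := []) (by simp)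
    simp only [List.length_append, List.length_map, symReads_append, symReads_map_inl,
      symReads_map_inr]
    nlinarith
  · obtain ⟨p₁, p₂, rfl, rfl, rfl⟩ := List.map_eq_append_iff.1 hw
    have := key rfl
    simp only [List.length_map, symReads_map_inl]
    nlinarith

end OracleNPDA

/-- If the complement of every language recognized with the oracle `A` may serve as an oracle,
then the functions computed with the oracle `A` have single-valued refinements. -/
theorem exists_refinement {σ γ β : Type} [Finite σ] [Finite γ] {A : Language β}
    {𝒞 : LanguageFamily} (h𝒞 : ∀ (κ : Type) [Finite κ] (L : Language κ), L ∈ CFLT A κ → Lᶜ ∈ 𝒞 κ)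
    {g : MVFun σ γ} (hg : g ∈ CFLMVT A σ γ) :
    ∃ f ∈ CFLSVTFamily 𝒞 σ γ, MVFun.IsRefinementOf f g := by
  obtain ⟨M, hM, hg⟩ := hg
  obtain ⟨code, hcode⟩ := exists_injective_nat M.Label
  obtain ⟨a, b, hab⟩ := id hM
  let E := (M.checker code).toOracleNPDA
  let L : Language M.PathSymbol := {z | E.Accepts A z}
  let N := (M.guesser (a + 1) (b + 1)).toOracleNPDA
  have hL : L ∈ CFLT A M.PathSymbol :=
    ⟨E, Prog.toOracleNPDA_linearTime (OracleNPDA.checker_bounded hM code), fun _ => Iff.rfl⟩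
  have hmem : ∀ {x z}, OracleNPDA.symReads z <+: inputTape x →
      (z ∈ Lᶜ ↔ OracleNPDA.EncodesLeast M A code x z) := by
    intro x z hz
    have h1 : z ∈ L ↔ ((M.checker code).outputs A z).Nonempty := by
      rw [← Prog.toOracleNPDA_outputs]
      exact E.accepts_iff A z
    rw [OracleNPDA.checker_outputs_nonempty_iff hz] at h1
    exact (not_congr h1).trans not_not
  have hN : ∀ x o, o ∈ N.outputs Lᶜ x ↔
      ∃ z, OracleNPDA.EncodesLeast M A code x z ∧ OracleNPDA.symOuts z = o := by
    intro x o
    rw [Prog.toOracleNPDA_outputs, OracleNPDA.mem_guesser_outputs_iff]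
    · constructor
      · rintro ⟨z, hz, hx, rfl⟩
        exact ⟨z, (hmem hx).1 hz, rfl⟩
      · rintro ⟨z, hz, rfl⟩
        have hx : OracleNPDA.symReads z <+: inputTape x := by
          obtain ⟨p, r, rfl, ⟨d, -, -, hx⟩, -⟩ := hz
          rw [OracleNPDA.symReads_encode, hx]
        exact ⟨z, (hmem hx).2 hz, hx, rfl⟩
    · intro z hz hx z₁ k z₂ h
      exact ((hmem hx).1 hz).length_lt hab h
  refine ⟨fun x => N.outputs Lᶜ x, ⟨M.PathSymbol, inferInstance, Lᶜ, h𝒞 _ L hL, ⟨N,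
    Prog.toOracleNPDA_linearTime (OracleNPDA.guesser_bounded M _ _), fun _ => rfl⟩, ?_⟩, ?_⟩
  · intro x o ho o' ho'
    obtain ⟨z, hz, rfl⟩ := (hN x o).1 ho
    obtain ⟨z', hz', rfl⟩ := (hN x o').1 ho'
    -- Both outputs are read off from the same least path.
    rw [hz.unique hcode hz']
  · have hsub : ∀ x, N.outputs Lᶜ x ⊆ g x := by
      intro x o ho
      obtain ⟨z, ⟨p, r, rfl, hp, -⟩, rfl⟩ := (hN x o).1 ho
      rw [hg x, OracleNPDA.symOuts_encode]
      exact OracleNPDA.mem_outputs_iff.2 ⟨p, r, hp, rfl⟩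
    refine ⟨Set.Subset.antisymm (fun x hx => hx.mono (hsub x)) ?_, hsub⟩
    rintro x ⟨o, ho⟩
    rw [hg x] at ho
    obtain ⟨p, r, hp, -⟩ := OracleNPDA.mem_outputs_iff.1 ho
    obtain ⟨z, hz⟩ := OracleNPDA.exists_encodesLeast hab code hp
    exact ⟨_, (hN x _).2 ⟨z, hz, rfl⟩⟩

end CFLHierarchy

theorem mainTheorem2 (k : ℕ) (hk : 2 ≤ k)
    (hcollapse : CFLHierarchy.SigmaCFL k = CFLHierarchy.SigmaCFL (k + 1)) :
    CFLHierarchy.FunctionClass.RefinedBy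
      (CFLHierarchy.SigmaCFLMV (k + 1)) (CFLHierarchy.SigmaCFLSV (k + 1)) := by
  obtain ⟨m, rfl⟩ : ∃ m, k = m + 1 := ⟨k - 1, by omega⟩
  rintro σ γ _ _ g ⟨β, hβ, A, hA, hg⟩
  refine CFLHierarchy.exists_refinement (fun κ _ L hL => ?_) hg
  -- Since `A` lies in Π_k, the language `L` is in Σ_{k+1}; the collapse puts it in Σ_k, so that its
  -- complement is an oracle in Π_k.
  change Lᶜᶜ ∈ CFLHierarchy.SigmaCFL (m + 1) κ
  rw [compl_compl, hcollapse]
  exact ⟨β, hβ, A, hA, hL⟩
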